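/- **Theorem 2 (Proximal operator for the tensor logarithmic composite norm).** Let $I_1,I_2\ge 0$ and $I_3\ge 1$ be integers, $R=\min\{I_1,I_2\}$, and $\rho,\nu,\vartheta>0$. For a real $I_1\times I_2\times I_3$ tensor $\mathcal X$ let $\bar{\mathcal X}$ be its (unnormalized) discrete Fourier transform along the third mode, $\bar{\mathcal X}^{(i)}$ the $i$-th frontal slice of $\bar{\mathcal X}$, and $\sigma_1(\bar{\mathcal X}^{(i)})\ge\dots\ge\sigma_R(\bar{\mathcal X}^{(i)})\ge 0$ its singular values. Put $$\|\mathcal X\|_{LC}=\frac1{I_3}\sum_{i=1}^{I_3}\sum_{j=1}^{R}\omega_{j,i}\log\bigl(g(\sigma_j(\bar{\mathcal X}^{(i)}))+1\bigr),\qquad g(s)=\begin{cases}\nu s-s^2/(2\vartheta), & s\le\nu\vartheta,\\ \nu^2\vartheta/2, & s>\nu\vartheta,\end{cases}$$ with weights $\omega_{j,i}=1/(c+e^{-w_{R-j+1,i}})$, where $c\ge 0$ and $w_{j,i}\in\mathbb R$ are fixed and $w_{j,i}=w_{j,i'}$ whenever the slices $i,i'$ are complex conjugates of each other in the Fourier domain,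 i.e. $(i-1)+(i'-1)\equiv 0 \pmod{I_3}$. Let $\mathcal Y$ be a real $I_1\times I_2\times I_3$ tensor such that $$\omega_{j,i}\,\sigma_k(\bar{\mathcal Y}^{(i)})\le\omega_{k,i}\,\sigma_j(\bar{\mathcal Y}^{(i)})\qquad(1\le j\le k\le R,\ 1\le i\le I_3)$$ (this holds for every $\mathcal Y$ if $\omega_{1,i}\le\dots\le\omega_{R,i}$ for all $i$). For $\omega>0$, $y\ge 0$ let $h_{\omega,y}(l)=\frac{\rho}{2}(l-y)^2+\omega\log(g(l)+1)$, and let $P_\omega(y)$ be the set of minimizers of $h_{\omega,y}$ over $l\ge 0$. Let $C_\omega(y)$ be the set consisting of $0$, $\nu\vartheta$ and the numbers $\min\{\max\{l,0\},\nu\vartheta\}$, where $l$ runs through the real roots of $$-l^{3}+(2\nu\vartheta+y)l^{2}+\Bigl(-\frac{2\omega}{\rho}+2\vartheta-2\nu\vartheta y\Bigr)l+\Bigl(\frac{2\omega\nu\vartheta}{\rho}-2\vartheta y\Bigr)=0 .$$ A t-SVD of a real tensor $\mathcal X$ means a factorization $\mathcal X=\mathcal U*\mathcal S*\mathcal V^H$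 (t-product) with real orthogonal tensors $\mathcal U,\mathcal V$ and a real f-diagonal tensor $\mathcal S$ such that $\bar{\mathcal S}^{(i)}$ has diagonal entries $\sigma_1(\bar{\mathcal X}^{(i)}),\dots,\sigma_R(\bar{\mathcal X}^{(i)})$ for every $i$. Let $S(\mathcal Y)$ be the set of minimizers over real tensors $\mathcal L$ of $\frac{\rho}{2}\|\mathcal L-\mathcal Y\|_F^2+\|\mathcal L\|_{LC}$. Then: 1. For all $\omega>0$, $y\ge0$ the set $P_\omega(y)$ is nonempty. A number $l$ belongs to $P_\omega(y)$ if and only if either $l\in C_\omega(y)$, $l$ minimizes $h_{\omega,y}$ over $C_\omega(y)$ and $h_{\omega,y}(l)\le h_{\omega,y}(y)$; or $l>\nu\vartheta$, $l=y$ and $h_{\omega,y}(y)\le h_{\omega,y}(x)$ for all $x\in C_\omega(y)$. In particular a minimizer $l>\nu\vartheta$ equals $y$. If $\nu\vartheta$ minimizes $h_{\omega,y}$ over $C_\omega(y)$, then $y\in P_\omega(y)$. 2. $\mathcal Y$ has a t-SVD. Let $S_{LC}$ be any function with $S_{LC}(\omega,y)\in P_\omega(y)$ for all $\omega>0$, $y\ge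 0$, and let $\mathcal Y=\mathcal U*\mathcal S_2*\mathcal V^H$ be any t-SVD of $\mathcal Y$. Then there is a tensor $\mathcal S_1$ such that, for $\mathcal L=\mathcal U*\mathcal S_1*\mathcal V^H$, this factorization is a t-SVD of $\mathcal L$, $\sigma_j(\bar{\mathcal L}^{(i)})=S_{LC}(\omega_{j,i},\sigma_j(\bar{\mathcal Y}^{(i)}))$ for all $i,j$, and $\mathcal L\in S(\mathcal Y)$. 3. A tensor $\mathcal L$ belongs to $S(\mathcal Y)$ if and only if there are t-SVDs $\mathcal Y=\mathcal U*\mathcal S_2*\mathcal V^H$ and $\mathcal L=\mathcal U*\mathcal S_1*\mathcal V^H$ with the same $\mathcal U,\mathcal V$ such that $\sigma_j(\bar{\mathcal L}^{(i)})\in P_{\omega_{j,i}}(\sigma_j(\bar{\mathcal Y}^{(i)}))$ for all $i,j$. -/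

import Mathlib

open scoped Matrix

namespace TensorLC

/-- Third-order tensors of size `n₁ × n₂ × n₃`, given by their frontal slices
`X k = X(:, :, k)`, `k = 0, …, n₃ - 1`. -/
abbrev Tensor3 (α : Type*) (n₁ n₂ n₃ : ℕ) : Type _ :=
  Fin n₃ → Matrix (Fin n₁) (Fin n₂) α

/-- Block circulant matrix: the block in position `(p, q)` is the slice of index
`p - q` modulo `n₃`. -/
def bcirc {α : Type*} {n₁ n₂ n₃ : ℕ} (A : Tensor3 α n₁ n₂ n₃) :
    Matrix (Fin n₃ × Fin n₁) (Fin n₃ × Fin n₂) α :=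
  Matrix.of fun p q => A (p.1 - q.1) p.2 q.2

/-- Block vectorization: the frontal slices stacked on top of each other. -/
def bvec {α : Type*} {n₁ n₂ n₃ : ℕ} (B : Tensor3 α n₁ n₂ n₃) :
    Matrix (Fin n₃ × Fin n₁) (Fin n₂) α :=
  Matrix.of fun p j => B p.1 p.2 j

/-- Inverse of block vectorization. -/
def bvfold {α : Type*} {n₁ n₂ n₃ : ℕ} (M : Matrix (Fin n₃ × Fin n₁) (Fin n₂) α) :
    Tensor3 α n₁ n₂ n₃ :=
  fun k => Matrix.of fun i j => M (k, i) j

/-- The t-product `A * B`. -/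
def tMul {α : Type*} [NonUnitalNonAssocSemiring α] {n₁ n₂ m n₃ : ℕ}
    (A : Tensor3 α n₁ n₂ n₃) (B : Tensor3 α n₂ m n₃) : Tensor3 α n₁ m n₃ :=
  bvfold (bcirc A * bvec B)

/-- Tensor conjugate transpose: every frontal slice is conjugate transposed, and the order of
all slices but the first is reversed. -/
def tconj {α : Type*} [Star α] {n₁ n₂ n₃ : ℕ} (A : Tensor3 α n₁ n₂ n₃) :
    Tensor3 α n₂ n₁ n₃ :=
  fun k => (A (-k))ᴴ

/-- Identity tensor: first frontal slice the identity matrix, all others zero. -/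
def tid (n n₃ : ℕ) : Tensor3 ℝ n n n₃ :=
  fun k => if k.val = 0 then 1 else 0

/-- Orthogonal tensors. -/
def IsOrthogonal {n n₃ : ℕ} (Q : Tensor3 ℝ n n n₃) : Prop :=
  tMul Q (tconj Q) = tid n n₃ ∧ tMul (tconj Q) Q = tid n n₃

/-- f-diagonal tensors: every frontal slice is a (rectangular) diagonal matrix. -/
def IsFDiagonal {α : Type*} [Zero α] {n₁ n₂ n₃ : ℕ} (S : Tensor3 α n₁ n₂ n₃) : Prop :=
  ∀ (k : Fin n₃) (a : Fin n₁) (b : Fin n₂), a.val ≠ b.val → S k a b = 0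

/-- Unnormalized discrete Fourier transform along the third mode (`fft(X, [], 3)`). -/
noncomputable def dft {n₁ n₂ n₃ : ℕ} (X : Tensor3 ℝ n₁ n₂ n₃) : Tensor3 ℂ n₁ n₂ n₃ :=
  fun k => Matrix.of fun a b => ∑ t : Fin n₃,
    Complex.exp (-(2 * Real.pi * Complex.I * (k.val : ℂ) * (t.val : ℂ) / (n₃ : ℂ))) *
      (X t a b : ℂ)

/-- Frobenius norm of a real tensor. -/
noncomputable def frobNorm {n₁ n₂ n₃ : ℕ} (X : Tensor3 ℝ n₁ n₂ n₃) : ℝ :=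
  Real.sqrt (∑ k, ∑ a, ∑ b, X k a b ^ 2)

/-- `sv X i j` is the `j`-th singular value (in nonincreasing order, `j` counted from `0`) of the
`i`-th frontal slice of the DFT of `X`. -/
noncomputable def sv {n₁ n₂ n₃ : ℕ} (X : Tensor3 ℝ n₁ n₂ n₃) (i : Fin n₃)
    (j : Fin (min n₁ n₂)) : ℝ :=
  (Matrix.toEuclideanLin (dft X i)).singularValues j

/-- `X = U * S * Vᴴ` is a t-SVD of `X`: `U`, `V` are orthogonal tensors, `S` is f-diagonal, and
the diagonal of each frontal slice of the DFT of `S` lists the singular values of the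
corresponding frontal slice of the DFT of `X`. -/
structure IsTSVD {n₁ n₂ n₃ : ℕ} (X : Tensor3 ℝ n₁ n₂ n₃) (U : Tensor3 ℝ n₁ n₁ n₃)
    (S : Tensor3 ℝ n₁ n₂ n₃) (V : Tensor3 ℝ n₂ n₂ n₃) : Prop where
  orthogonal_left : IsOrthogonal U
  orthogonal_right : IsOrthogonal V
  fDiagonal : IsFDiagonal S
  dft_diag : ∀ (i : Fin n₃) (j : Fin (min n₁ n₂)),
    dft S i (Fin.castLE (min_le_left n₁ n₂) j) (Fin.castLE (min_le_right n₁ n₂) j) =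
      (sv X i j : ℂ)
  factorization : X = tMul (tMul U S) (tconj V)

/-- The scalar function `g` (a minimax concave penalty). -/
noncomputable def mcp (ν ϑ s : ℝ) : ℝ :=
  if s ≤ ν * ϑ then ν * s - s ^ 2 / (2 * ϑ) else ν ^ 2 * ϑ / 2

/-- The weights `ω_{j,i} = 1 / (c + exp (- w_{R-j+1,i}))`; `Fin.rev j` is `R - j + 1` in
one-based indexing. -/
noncomputable def weight {R n₃ : ℕ} (c : ℝ) (w : Fin R → Fin n₃ → ℝ) (j : Fin R)
    (i : Fin n₃) : ℝ :=
  1 / (c + Real.exp (-(w (Fin.rev j) i)))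

/-- The tensor logarithmic composite norm. -/
noncomputable def lcNorm {n₁ n₂ n₃ : ℕ} (ν ϑ c : ℝ) (w : Fin (min n₁ n₂) → Fin n₃ → ℝ)
    (X : Tensor3 ℝ n₁ n₂ n₃) : ℝ :=
  1 / (n₃ : ℝ) * ∑ i : Fin n₃, ∑ j : Fin (min n₁ n₂),
    weight c w j i * Real.log (mcp ν ϑ (sv X i j) + 1)

/-- Objective function of the tensor proximal problem. -/
noncomputable def proxObjective {n₁ n₂ n₃ : ℕ} (ρ ν ϑ c : ℝ)
    (w : Fin (min n₁ n₂) → Fin n₃ → ℝ) (Y L : Tensor3 ℝ n₁ n₂ n₃) : ℝ :=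
  ρ / 2 * frobNorm (L - Y) ^ 2 + lcNorm ν ϑ c w L

/-- The proximal map as a set of minimizers, `argmin_L (ρ/2) ‖L - Y‖_F² + ‖L‖_LC`. -/
def proxSet {n₁ n₂ n₃ : ℕ} (ρ ν ϑ c : ℝ) (w : Fin (min n₁ n₂) → Fin n₃ → ℝ)
    (Y : Tensor3 ℝ n₁ n₂ n₃) : Set (Tensor3 ℝ n₁ n₂ n₃) :=
  {L | ∀ L', proxObjective ρ ν ϑ c w Y L ≤ proxObjective ρ ν ϑ c w Y L'}

/-- Objective function `h` of the scalar proximal problem. -/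
noncomputable def scalarObjective (ρ ν ϑ ω y l : ℝ) : ℝ :=
  ρ / 2 * (l - y) ^ 2 + ω * Real.log (mcp ν ϑ l + 1)

/-- The set of minimizers of the scalar problem over `l ≥ 0` (`l` stands for a singular value). -/
def scalarProxSet (ρ ν ϑ ω y : ℝ) : Set ℝ :=
  {l | 0 ≤ l ∧ ∀ l', 0 ≤ l' → scalarObjective ρ ν ϑ ω y l ≤ scalarObjective ρ ν ϑ ω y l'}

/-- The cubic equation satisfied by the stationary points of `h` in `[0, νϑ]`. -/
def IsCubicRoot (ρ ν ϑ ω y l : ℝ) : Prop :=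
  -l ^ 3 + (2 * ν * ϑ + y) * l ^ 2 + (-(2 * ω) / ρ + 2 * ϑ - 2 * ν * ϑ * y) * l +
    (2 * ω * ν * ϑ / ρ - 2 * ϑ * y) = 0

/-- The endpoints of `[0, νϑ]` together with the real cubic roots clipped to `[0, νϑ]`. -/
def candidates (ρ ν ϑ ω y : ℝ) : Set ℝ :=
  {0, ν * ϑ} ∪ {x | ∃ l, IsCubicRoot ρ ν ϑ ω y l ∧ x = min (max l 0) (ν * ϑ)}

end TensorLC

open TensorLC

/-! Parseval for the unnormalized transform has the factor `n₃`, which matches the `1 / n₃` in the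
norm, so `n₃` times the tensor objective splits into Fourier slices. Mirsky's inequality bounds
`‖L̄⁽ⁱ⁾ - Ȳ⁽ⁱ⁾‖²` below by `∑ⱼ (σⱼ(L̄⁽ⁱ⁾) - σⱼ(Ȳ⁽ⁱ⁾))²`. Hence (`proxObjective_eq`) `n₃` times the
objective is a sum of scalar objectives at the singular values plus `ρ / 2` times a sum of
nonnegative gaps. A gap vanishes exactly when the two slices have a common singular value
decomposition. Keeping the factors of `Y` and replacing each singular value by a scalar minimizer
therefore minimizes both terms at once, provided the new values are still nonincreasing in `j`. The
order condition on weights and data guarantees this (`scalarProx_antitone`). Conversely, a minimizer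
must have zero gaps and be optimal in every scalar term.

Mirsky's inequality is von Neumann's trace inequality, whose equality case is also needed. By
compactness `Re tr ((U A V)ᴴ B)` has a maximum over unitary pairs. If the maximum is at `(1, 1)`,
differentiating along one-parameter groups shows that `A Bᴴ` and `Aᴴ B` are Hermitian. Then `AᴴA`,
`BᴴB`, `AᴴB` commute and have a common eigenbasis, which yields common singular vectors up to signs
and order (`exists_common_signed_svd`). The rearrangement inequality finishes the bound, and its
equality case removes the signs and sorts both families together (`exists_common_svd`).

To return to real tensors, the slice factors are chosen conjugate symmetrically. A self-conjugate
slice is a real matrix and needs real factors, so the matrix theory is developed over `RCLike`.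

The scalar problem is elementary: the penalty is constant beyond `νϑ`, so `y` beats every point
there, and an interior minimizer on `[0, νϑ]` solves the cubic. -/

namespace TensorLC

/-! ### The scalar proximal problem -/

section Scalar

variable {ρ ν ϑ ω y : ℝ}

/-- The positive part glues the two branches into one formula, from which continuity, monotonicity
and the upper bound can be read off. -/
lemma mcp_eq_sub (hϑ : 0 < ϑ) (s : ℝ) :
    mcp ν ϑ s = ν ^ 2 * ϑ / 2 - (max (ν * ϑ - s) 0) ^ 2 / (2 * ϑ) := by
  unfold mcp
  split_ifs with h
  · rw [max_eq_left (by linarith)]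
    field_simp
    ring
  · rw [max_eq_right (by linarith)]
    simp

lemma mcp_of_ge (hϑ : 0 < ϑ) {s : ℝ} (hs : ν * ϑ ≤ s) : mcp ν ϑ s = ν ^ 2 * ϑ / 2 := by
  rw [mcp_eq_sub hϑ, max_eq_right (by linarith)]
  simp

lemma continuous_mcp (hϑ : 0 < ϑ) : Continuous (mcp ν ϑ) := by
  have : mcp ν ϑ = fun s => ν ^ 2 * ϑ / 2 - (max (ν * ϑ - s) 0) ^ 2 / (2 * ϑ) :=
    funext (mcp_eq_sub hϑ)
  rw [this]
  fun_prop

lemma mcp_mono (hϑ : 0 < ϑ) : Monotone (mcp ν ϑ) := by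
  intro s t hst
  rw [mcp_eq_sub hϑ, mcp_eq_sub hϑ]
  gcongr

lemma mcp_zero (hν : 0 < ν) (hϑ : 0 < ϑ) : mcp ν ϑ 0 = 0 := by
  unfold mcp
  rw [if_pos (by positivity)]
  simp

lemma mcp_nonneg (hν : 0 < ν) (hϑ : 0 < ϑ) {s : ℝ} (hs : 0 ≤ s) : 0 ≤ mcp ν ϑ s :=
  mcp_zero hν hϑ ▸ mcp_mono hϑ hs

lemma mcp_le (hϑ : 0 < ϑ) (s : ℝ) : mcp ν ϑ s ≤ ν ^ 2 * ϑ / 2 := by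
  rw [mcp_eq_sub hϑ]
  have : 0 ≤ (max (ν * ϑ - s) 0) ^ 2 / (2 * ϑ) := by positivity
  linarith

/-- The common value of the penalty on `[νϑ, ∞)`. -/
noncomputable def logPenaltyMax (ν ϑ : ℝ) : ℝ := Real.log (ν ^ 2 * ϑ / 2 + 1)

lemma log_mcp_le (hν : 0 < ν) (hϑ : 0 < ϑ) {s : ℝ} (hs : 0 ≤ s) :
    Real.log (mcp ν ϑ s + 1) ≤ logPenaltyMax ν ϑ :=
  Real.log_le_log (by linarith [mcp_nonneg hν hϑ hs]) (by linarith [mcp_le (ν := ν) hϑ s])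

lemma log_mcp_of_ge (hϑ : 0 < ϑ) {s : ℝ} (hs : ν * ϑ ≤ s) :
    Real.log (mcp ν ϑ s + 1) = logPenaltyMax ν ϑ := by
  rw [mcp_of_ge hϑ hs, logPenaltyMax]

lemma log_mcp_mono (hν : 0 < ν) (hϑ : 0 < ϑ) {s t : ℝ} (hs : 0 ≤ s) (hst : s ≤ t) :
    Real.log (mcp ν ϑ s + 1) ≤ Real.log (mcp ν ϑ t + 1) :=
  Real.log_le_log (by linarith [mcp_nonneg hν hϑ hs]) (by linarith [mcp_mono (ν := ν) hϑ hst])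

lemma scalarObjective_of_ge (hϑ : 0 < ϑ) {l : ℝ} (hl : ν * ϑ ≤ l) :
    scalarObjective ρ ν ϑ ω y l = ρ / 2 * (l - y) ^ 2 + ω * logPenaltyMax ν ϑ := by
  rw [scalarObjective, log_mcp_of_ge hϑ hl]

/-- At `l = y` the quadratic term vanishes and the penalty is at most its plateau value. So `y` is
at least as good as every point of `[νϑ, ∞)`, even when `y` itself lies below `νϑ`. -/
lemma scalarObjective_self_le (hν : 0 < ν) (hϑ : 0 < ϑ) (hω : 0 < ω) (hy : 0 ≤ y) :
    scalarObjective ρ ν ϑ ω y y ≤ ω * logPenaltyMax ν ϑ := by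
  rw [scalarObjective]
  have := mul_le_mul_of_nonneg_left (log_mcp_le hν hϑ hy) hω.le
  simpa using this

lemma continuousOn_scalarObjective (hν : 0 < ν) (hϑ : 0 < ϑ) :
    ContinuousOn (scalarObjective ρ ν ϑ ω y) (Set.Ici 0) := by
  unfold scalarObjective
  refine ContinuousOn.add (by fun_prop) (continuousOn_const.mul (ContinuousOn.log ?_ ?_))
  · exact ((continuous_mcp hϑ).add continuous_const).continuousOn
  · intro s hs
    have := mcp_nonneg hν hϑ (Set.mem_Ici.1 hs)
    linarith

lemma isCubicRoot_of_isLocalMin (hρ : 0 < ρ) (hν : 0 < ν) (hϑ : 0 < ϑ) {l : ℝ} (hl0 : 0 < l)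
    (hl1 : l < ν * ϑ) (hmin : IsLocalMin (scalarObjective ρ ν ϑ ω y) l) :
    IsCubicRoot ρ ν ϑ ω y l := by
  have hg : HasDerivAt (mcp ν ϑ) (ν - l / ϑ) l := by
    have h1 : HasDerivAt (fun s : ℝ => ν * s - s ^ 2 / (2 * ϑ))
        (ν * 1 - (2 : ℕ) * l ^ (2 - 1) * 1 / (2 * ϑ)) l :=
      ((hasDerivAt_id l).const_mul ν).sub (((hasDerivAt_id l).pow 2).div_const _)
    have h2 : (ν * 1 - (2 : ℕ) * l ^ (2 - 1) * 1 / (2 * ϑ)) = ν - l / ϑ := by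
      push_cast
      field_simp
    rw [h2] at h1
    refine h1.congr_of_eventuallyEq ?_
    filter_upwards [Iio_mem_nhds hl1] with s hs
    rw [mcp, if_pos (Set.mem_Iio.1 hs).le]
  have hpos : 0 < mcp ν ϑ l + 1 := by linarith [mcp_nonneg hν hϑ hl0.le]
  have hd : HasDerivAt (scalarObjective ρ ν ϑ ω y)
      (ρ / 2 * ((2 : ℕ) * (l - y) ^ (2 - 1) * 1) + ω * ((ν - l / ϑ) / (mcp ν ϑ l + 1))) l :=
    (((((hasDerivAt_id l).sub_const y).pow 2).const_mul (ρ / 2))).add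
      (((hg.add_const 1).log hpos.ne').const_mul ω)
  have h0 := hmin.hasDerivAt_eq_zero hd
  have hgl : mcp ν ϑ l = ν * l - l ^ 2 / (2 * ϑ) := by rw [mcp, if_pos hl1.le]
  have h1 : ρ * (l - y) * (ν * l - l ^ 2 / (2 * ϑ) + 1) + ω * (ν - l / ϑ) = 0 := by
    rw [← hgl]
    have := congrArg (· * (mcp ν ϑ l + 1)) h0
    simp only [zero_mul] at this
    rw [← this]
    field_simp
    push_cast
    ring
  -- This factor normalizes the leading coefficient of the cubic to `-1`.
  have h2 := congrArg (· * (2 * ϑ / ρ)) h1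
  simp only [zero_mul] at h2
  rw [IsCubicRoot, ← h2]
  field_simp
  ring

lemma candidates_subset (hν : 0 < ν) (hϑ : 0 < ϑ) {x : ℝ} (hx : x ∈ candidates ρ ν ϑ ω y) :
    0 ≤ x ∧ x ≤ ν * ϑ := by
  have hm : 0 ≤ ν * ϑ := by positivity
  rcases hx with (rfl | rfl) | ⟨l, -, rfl⟩
  · exact ⟨le_rfl, hm⟩
  · exact ⟨hm, le_rfl⟩
  · exact ⟨le_min (le_max_right _ _) hm, min_le_right _ _⟩

/-- A minimizer on `[0, νϑ]` is an endpoint or an interior stationary point, and clipping does not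
move the latter. -/
lemma mem_candidates_of_isMinOn (hρ : 0 < ρ) (hν : 0 < ν) (hϑ : 0 < ϑ) {l : ℝ} (hl0 : 0 ≤ l)
    (hl1 : l ≤ ν * ϑ)
    (hmin : ∀ x, 0 ≤ x → x ≤ ν * ϑ →
      scalarObjective ρ ν ϑ ω y l ≤ scalarObjective ρ ν ϑ ω y x) :
    l ∈ candidates ρ ν ϑ ω y := by
  rcases hl0.eq_or_lt with rfl | h0
  · exact Or.inl (Or.inl rfl)
  rcases hl1.eq_or_lt with rfl | h1
  · exact Or.inl (Or.inr rfl)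
  refine Or.inr ⟨l, isCubicRoot_of_isLocalMin hρ hν hϑ h0 h1 ?_, ?_⟩
  · filter_upwards [Ioo_mem_nhds h0 h1] with x hx
    exact hmin x hx.1.le hx.2.le
  · rw [max_eq_left hl0, min_eq_left hl1]

lemma exists_candidate_le (hρ : 0 < ρ) (hν : 0 < ν) (hϑ : 0 < ϑ) (ω y : ℝ) :
    ∃ x ∈ candidates ρ ν ϑ ω y, ∀ l, 0 ≤ l → l ≤ ν * ϑ →
      scalarObjective ρ ν ϑ ω y x ≤ scalarObjective ρ ν ϑ ω y l := by
  obtain ⟨x, hx, hmin⟩ := isCompact_Icc.exists_isMinOn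
    (Set.nonempty_Icc.2 (by positivity : 0 ≤ ν * ϑ))
    ((continuousOn_scalarObjective (ρ := ρ) (ω := ω) (y := y) hν hϑ).mono Set.Icc_subset_Ici_self)
  have h : ∀ l, 0 ≤ l → l ≤ ν * ϑ →
      scalarObjective ρ ν ϑ ω y x ≤ scalarObjective ρ ν ϑ ω y l :=
    fun l h0 h1 => hmin ⟨h0, h1⟩
  exact ⟨x, mem_candidates_of_isMinOn hρ hν hϑ hx.1 hx.2 h, h⟩

lemma logPenaltyMax_le_scalarObjective (hρ : 0 < ρ) (hϑ : 0 < ϑ) {l : ℝ} (hl : ν * ϑ ≤ l) :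
    ω * logPenaltyMax ν ϑ ≤ scalarObjective ρ ν ϑ ω y l := by
  rw [scalarObjective_of_ge hϑ hl]
  have : 0 ≤ ρ / 2 * (l - y) ^ 2 := by positivity
  linarith

/-- Some candidate is optimal on `[0, νϑ]`, and `y` is at least as good as all of `[νϑ, ∞)`; beating
these suffices. -/
lemma mem_scalarProxSet_of_le (hρ : 0 < ρ) (hν : 0 < ν) (hϑ : 0 < ϑ) (hω : 0 < ω) (hy : 0 ≤ y)
    {l : ℝ} (hl : 0 ≤ l)
    (hC : ∀ x ∈ candidates ρ ν ϑ ω y,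
      scalarObjective ρ ν ϑ ω y l ≤ scalarObjective ρ ν ϑ ω y x)
    (hly : scalarObjective ρ ν ϑ ω y l ≤ scalarObjective ρ ν ϑ ω y y) :
    l ∈ scalarProxSet ρ ν ϑ ω y := by
  refine ⟨hl, fun l' h' => ?_⟩
  obtain ⟨x, hx, hmin⟩ := exists_candidate_le hρ hν hϑ ω y
  rcases le_total l' (ν * ϑ) with h | h
  · exact (hC x hx).trans (hmin l' h' h)
  · exact hly.trans ((scalarObjective_self_le hν hϑ hω hy).trans
      (logPenaltyMax_le_scalarObjective hρ hϑ h))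

/-- On the plateau, any positive quadratic term would make `y` strictly better. The boundary point
`νϑ` is included, as the monotonicity argument requires. -/
lemma eq_of_mem_scalarProxSet_of_ge (hρ : 0 < ρ) (hν : 0 < ν) (hϑ : 0 < ϑ) (hω : 0 < ω)
    (hy : 0 ≤ y) {l : ℝ} (hl : l ∈ scalarProxSet ρ ν ϑ ω y) (hlt : ν * ϑ ≤ l) : l = y := by
  have h1 := (hl.2 y hy).trans (scalarObjective_self_le hν hϑ hω hy)
  rw [scalarObjective_of_ge hϑ hlt] at h1
  have h2 : (l - y) ^ 2 ≤ 0 := by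
    by_contra! h
    have : 0 < ρ / 2 * (l - y) ^ 2 := by positivity
    linarith
  have h3 := pow_eq_zero_iff (two_ne_zero) |>.1 (le_antisymm h2 (sq_nonneg _))
  linarith

lemma mem_scalarProxSet_iff (hρ : 0 < ρ) (hν : 0 < ν) (hϑ : 0 < ϑ) (hω : 0 < ω) (hy : 0 ≤ y)
    (l : ℝ) :
    l ∈ scalarProxSet ρ ν ϑ ω y ↔
      (l ∈ candidates ρ ν ϑ ω y ∧
        (∀ x ∈ candidates ρ ν ϑ ω y,
          scalarObjective ρ ν ϑ ω y l ≤ scalarObjective ρ ν ϑ ω y x) ∧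
        scalarObjective ρ ν ϑ ω y l ≤ scalarObjective ρ ν ϑ ω y y) ∨
      (ν * ϑ < l ∧ l = y ∧
        ∀ x ∈ candidates ρ ν ϑ ω y,
          scalarObjective ρ ν ϑ ω y y ≤ scalarObjective ρ ν ϑ ω y x) := by
  constructor
  · intro h
    have hC : ∀ x ∈ candidates ρ ν ϑ ω y,
        scalarObjective ρ ν ϑ ω y l ≤ scalarObjective ρ ν ϑ ω y x :=
      fun x hx => h.2 x (candidates_subset hν hϑ hx).1
    rcases le_or_gt l (ν * ϑ) with hl | hl
    · exact Or.inl ⟨mem_candidates_of_isMinOn hρ hν hϑ h.1 hl fun x hx _ => h.2 x hx, hC, h.2 y hy⟩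
    · obtain rfl := eq_of_mem_scalarProxSet_of_ge hρ hν hϑ hω hy h hl.le
      exact Or.inr ⟨hl, rfl, hC⟩
  · rintro (⟨h1, h2, h3⟩ | ⟨-, rfl, h3⟩)
    · exact mem_scalarProxSet_of_le hρ hν hϑ hω hy (candidates_subset hν hϑ h1).1 h2 h3
    · exact mem_scalarProxSet_of_le hρ hν hϑ hω hy hy h3 le_rfl

lemma scalarProxSet_nonempty (hρ : 0 < ρ) (hν : 0 < ν) (hϑ : 0 < ϑ) (hω : 0 < ω) (hy : 0 ≤ y) :
    (scalarProxSet ρ ν ϑ ω y).Nonempty := by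
  obtain ⟨x, hx, hmin⟩ := exists_candidate_le hρ hν hϑ ω y
  have hC : ∀ z ∈ candidates ρ ν ϑ ω y,
      scalarObjective ρ ν ϑ ω y x ≤ scalarObjective ρ ν ϑ ω y z := fun z hz =>
    hmin z (candidates_subset hν hϑ hz).1 (candidates_subset hν hϑ hz).2
  rcases le_total (scalarObjective ρ ν ϑ ω y x) (scalarObjective ρ ν ϑ ω y y) with h | h
  · exact ⟨x, mem_scalarProxSet_of_le hρ hν hϑ hω hy (candidates_subset hν hϑ hx).1 hC h⟩
  · exact ⟨y, mem_scalarProxSet_of_le hρ hν hϑ hω hy hy (fun z hz => h.trans (hC z hz)) le_rfl⟩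

lemma self_mem_scalarProxSet (hρ : 0 < ρ) (hν : 0 < ν) (hϑ : 0 < ϑ) (hω : 0 < ω) (hy : 0 ≤ y)
    (h : ∀ x ∈ candidates ρ ν ϑ ω y,
      scalarObjective ρ ν ϑ ω y (ν * ϑ) ≤ scalarObjective ρ ν ϑ ω y x) :
    y ∈ scalarProxSet ρ ν ϑ ω y := by
  have hyle : scalarObjective ρ ν ϑ ω y y ≤ scalarObjective ρ ν ϑ ω y (ν * ϑ) :=
    (scalarObjective_self_le hν hϑ hω hy).trans (logPenaltyMax_le_scalarObjective hρ hϑ le_rfl)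
  exact mem_scalarProxSet_of_le hρ hν hϑ hω hy hy (fun x hx => hyle.trans (h x hx)) le_rfl

/-- Under the order condition on weights and data, selected scalar minimizers are ordered like
the data. -/
lemma scalarProx_antitone (hρ : 0 < ρ) (hν : 0 < ν) (hϑ : 0 < ϑ) {SLC : ℝ → ℝ → ℝ}
    (hS : ∀ ω y : ℝ, 0 < ω → 0 ≤ y → SLC ω y ∈ scalarProxSet ρ ν ϑ ω y)
    {ω₁ ω₂ y₁ y₂ : ℝ} (h₁ : 0 < ω₁) (h₂ : 0 < ω₂) (hy₂ : 0 ≤ y₂) (hy : y₂ ≤ y₁)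
    (hord : ω₁ * y₂ ≤ ω₂ * y₁) : SLC ω₂ y₂ ≤ SLC ω₁ y₁ := by
  by_contra! hlt
  have hy₁ : 0 ≤ y₁ := hy₂.trans hy
  have m₁ := hS ω₁ y₁ h₁ hy₁
  have m₂ := hS ω₂ y₂ h₂ hy₂
  -- `SLC` is a function, so equal arguments cannot give different values; this settles ties among
  -- scalar minimizers.
  have hne : ¬ (ω₁ = ω₂ ∧ y₁ = y₂) := by
    rintro ⟨rfl, rfl⟩
    exact lt_irrefl _ hlt
  set a := SLC ω₁ y₁
  set b := SLC ω₂ y₂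
  have e₁ := m₁.2 b m₂.1
  have e₂ := m₂.2 a m₁.1
  simp only [scalarObjective] at e₁ e₂
  have hD := log_mcp_mono hν hϑ m₁.1 hlt.le
  have ha := m₁.1
  set p := Real.log (mcp ν ϑ a + 1) with hp
  set q := Real.log (mcp ν ϑ b + 1) with hq
  set d := ρ * (b - a) with hd
  have hdpos : 0 < d := mul_pos hρ (sub_pos.2 hlt)
  set s := (a + b) / 2 with hs
  have hspos : 0 < s := by linarith
  -- Each value is tested against the other; the difference of squares factors through the midpoint
  -- `s`.
  have f₁ : d * (y₁ - s) ≤ ω₁ * (q - p) := by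
    rw [hd, hs]; linarith
  have f₂ : ω₂ * (q - p) ≤ d * (y₂ - s) := by
    rw [hd, hs]; linarith
  -- Equal penalties force `y₁ = s = y₂`. Then either `b = y₂`, which is not the midpoint, or `b <
  -- νϑ`, where the penalty is strictly increasing; both are absurd.
  rcases hD.eq_or_lt with hpq | hpq
  · have g₁ : y₁ ≤ s := by
      rw [← hpq] at f₁
      by_contra! h
      have := mul_pos hdpos (sub_pos.2 h)
      linarith
    have g₂ : s ≤ y₂ := by
      rw [← hpq] at f₂
      by_contra! h
      have := mul_pos hdpos (sub_pos.2 h)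
      linarith
    have hby : b = y₂ ∨ b < ν * ϑ := by
      rcases le_or_gt (ν * ϑ) b with h | h
      · exact Or.inl (eq_of_mem_scalarProxSet_of_ge hρ hν hϑ h₂ hy₂ m₂ h)
      · exact Or.inr h
    rcases hby with h | h
    · linarith
    · have hstrict : p < q := by
        rw [hp, hq]
        refine Real.log_lt_log (by linarith [mcp_nonneg hν hϑ m₁.1]) ?_
        have : mcp ν ϑ a < mcp ν ϑ b := by
          have hϑ' := hϑ.ne'
          rw [mcp_eq_sub hϑ, mcp_eq_sub hϑ, max_eq_left (by linarith), max_eq_left (by linarith)]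
          have : (ν * ϑ - b) ^ 2 < (ν * ϑ - a) ^ 2 := by
            apply pow_lt_pow_left₀ <;> linarith
          have := div_lt_div_of_pos_right this (by positivity : 0 < 2 * ϑ)
          linarith
        linarith
      linarith
  · have hT : 0 < q - p := sub_pos.2 hpq
    have k₁ : ω₂ ≤ ω₁ := by
      have : ω₂ * (q - p) ≤ ω₁ * (q - p) := by
        refine f₂.trans (le_trans ?_ f₁)
        exact mul_le_mul_of_nonneg_left (by linarith) hdpos.le
      exact le_of_mul_le_mul_right this hT
    -- Cross-multiplying the two optimality inequalities by the weights lets `hord` cancel the terms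
    -- in `y₁`, `y₂`, leaving only the midpoint.
    have k₂ : ω₁ ≤ ω₂ := by
      have c₁ : ω₂ * (d * (y₁ - s)) ≤ ω₁ * (d * (y₂ - s)) :=
        calc ω₂ * (d * (y₁ - s)) ≤ ω₂ * (ω₁ * (q - p)) := mul_le_mul_of_nonneg_left f₁ h₂.le
          _ = ω₁ * (ω₂ * (q - p)) := by ring
          _ ≤ _ := mul_le_mul_of_nonneg_left f₂ h₁.le
      have c₂ : d * (ω₁ * s) ≤ d * (ω₂ * s) := by
        have := mul_le_mul_of_nonneg_left hord hdpos.le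
        linarith
      exact le_of_mul_le_mul_right (le_of_mul_le_mul_left c₂ hdpos) hspos
    have hω : ω₁ = ω₂ := le_antisymm k₂ k₁
    refine hne ⟨hω, le_antisymm ?_ hy⟩
    rw [hω] at f₁
    have := le_of_mul_le_mul_left (f₁.trans f₂) hdpos
    linarith

end Scalar

/-! ### Common singular value decompositions of linear maps -/

section CommonSVD

open Module InnerProductSpace

variable {𝕜 : Type*} [RCLike 𝕜]
  {E : Type*} [NormedAddCommGroup E] [InnerProductSpace 𝕜 E] [FiniteDimensional 𝕜 E]
  {F : Type*} [NormedAddCommGroup F] [InnerProductSpace 𝕜 F] [FiniteDimensional 𝕜 F]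

open scoped Function in
/-- Commuting symmetric operators have a common orthonormal basis of eigenvectors. -/
theorem exists_orthonormalBasis_of_commute {ι : Type*} {n : ℕ} {T : ι → E →ₗ[𝕜] E}
    (hn : finrank 𝕜 E = n) (hT : ∀ i, (T i).IsSymmetric) (hC : Pairwise (Commute on T)) :
    ∃ v : OrthonormalBasis (Fin n) 𝕜 E, ∀ j, ∃ μ : ι → 𝕜, ∀ i, T i (v j) = μ i • v j := by
  classical
  have hO := LinearMap.IsSymmetric.orthogonalFamily_iInf_eigenspaces hT
  let V : (ι → 𝕜) → Submodule 𝕜 E := fun χ => ⨅ i, End.eigenspace (T i) (χ i)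
  -- Only the nonzero joint eigenspaces are kept: there are finitely many, as an orthonormal basis
  -- subordinate to the decomposition requires.
  let J := {χ : ι → 𝕜 // V χ ≠ ⊥}
  have : Finite J := WellFoundedGT.finite_ne_bot_of_iSupIndep hO.independent
  have := Fintype.ofFinite J
  have hO' : OrthogonalFamily 𝕜 (fun χ : J => V χ) fun χ => (V χ).subtypeₗᵢ :=
    hO.comp Subtype.val_injective
  have hI : DirectSum.IsInternal (fun χ : J => V χ) := by
    rw [hO'.isInternal_iff, Submodule.orthogonal_eq_bot_iff]
    have := LinearMap.IsSymmetric.iSup_iInf_eq_top_of_commute hT hC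
    rw [eq_top_iff, ← this]
    refine iSup_le fun χ => ?_
    by_cases h : V χ = ⊥
    · exact le_of_eq_of_le h bot_le
    · exact le_iSup (fun χ : J => V χ) ⟨χ, h⟩
  refine ⟨hI.subordinateOrthonormalBasis hn hO', fun j => ?_⟩
  have hj := hI.subordinateOrthonormalBasis_subordinate hn j hO'
  exact ⟨_, fun i => End.mem_eigenspace_iff.1 ((Submodule.mem_iInf _).1 hj i)⟩

/-- If `T S† = S T†` and `T† S = S† T`, then `T` and `S` have common singular vectors, up to signs
and order of the singular values. -/
theorem exists_common_signed_svd {n : ℕ} (hn : finrank 𝕜 E = n) (T S : E →ₗ[𝕜] F)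
    (h₁ : T ∘ₗ S.adjoint = S ∘ₗ T.adjoint) (h₂ : T.adjoint ∘ₗ S = S.adjoint ∘ₗ T) :
    ∃ (v : OrthonormalBasis (Fin n) 𝕜 E) (u : Fin n → F) (a b : Fin n → ℝ),
      (∀ j, 0 ≤ a j) ∧ (∀ j, a j = 0 → 0 ≤ b j) ∧ (∀ j, T (v j) = (a j : 𝕜) • u j) ∧
      (∀ j, S (v j) = (b j : 𝕜) • u j) ∧ (∀ j k, j ≠ k → inner 𝕜 (u j) (u k) = 0) ∧
      (∀ j, ‖u j‖ = 1 ∨ (u j = 0 ∧ a j = 0 ∧ b j = 0)) ∧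
      (∀ j, u j ≠ 0 → a j ≠ 0 ∨ b j ≠ 0) := by
  have h₁' : ∀ x, T (S.adjoint x) = S (T.adjoint x) := fun x => LinearMap.congr_fun h₁ x
  have h₂' : ∀ x, T.adjoint (S x) = S.adjoint (T x) := fun x => LinearMap.congr_fun h₂ x
  -- The hypothesis `h₂` makes the third operator symmetric, and together with `h₁` makes all three
  -- commute.
  let Q : Fin 3 → E →ₗ[𝕜] E := ![T.adjoint ∘ₗ T, S.adjoint ∘ₗ S, T.adjoint ∘ₗ S]
  have hQ : ∀ i, (Q i).IsSymmetric := by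
    intro i
    fin_cases i
    · exact T.isSymmetric_adjoint_comp_self
    · exact S.isSymmetric_adjoint_comp_self
    · intro x y
      change inner 𝕜 (T.adjoint (S x)) y = inner 𝕜 x (T.adjoint (S y))
      rw [h₂', LinearMap.adjoint_inner_left, LinearMap.adjoint_inner_right]
  have c01 : Commute (Q 0) (Q 1) := by
    ext x
    simp [Q, ← h₁', ← h₂', Module.End.mul_apply]
  have c02 : Commute (Q 0) (Q 2) := by
    ext x
    simp [Q, h₁', h₂', Module.End.mul_apply]
  have c12 : Commute (Q 1) (Q 2) := by
    ext x
    simp [Q, h₁', h₂', Module.End.mul_apply]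
  have hC : Pairwise (Function.onFun Commute Q) := by
    intro i j hij
    fin_cases i <;> fin_cases j <;>
      first | exact absurd rfl hij | exact c01 | exact c02 | exact c12 | exact c01.symm |
        exact c02.symm | exact c12.symm
  obtain ⟨v, hv⟩ := exists_orthonormalBasis_of_commute hn hQ hC
  choose μ hμ using hv
  have hTT : ∀ j k, inner 𝕜 (T (v j)) (T (v k)) = μ k 0 * inner 𝕜 (v j) (v k) := by
    intro j k
    have := hμ k 0
    simp only [Q, Matrix.cons_val_zero, LinearMap.comp_apply] at this
    rw [← LinearMap.adjoint_inner_right, this, inner_smul_right]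
  have hSS : ∀ j k, inner 𝕜 (S (v j)) (S (v k)) = μ k 1 * inner 𝕜 (v j) (v k) := by
    intro j k
    have := hμ k 1
    simp only [Q, Matrix.cons_val_one, Matrix.cons_val_zero, LinearMap.comp_apply] at this
    rw [← LinearMap.adjoint_inner_right, this, inner_smul_right]
  have hTS : ∀ j k, inner 𝕜 (T (v j)) (S (v k)) = μ k 2 * inner 𝕜 (v j) (v k) := by
    intro j k
    have : T.adjoint (S (v k)) = μ k 2 • v k := hμ k 2
    rw [← LinearMap.adjoint_inner_right, this, inner_smul_right]
  have hvv : ∀ j, inner 𝕜 (v j) (v j) = (1 : 𝕜) := fun j => by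
    rw [inner_self_eq_norm_sq_to_K, v.orthonormal.1 j]; simp
  have hvo : ∀ j k, j ≠ k → inner 𝕜 (v j) (v k) = (0 : 𝕜) := fun j k h => v.orthonormal.2 h
  -- the product of the eigenvalues of `T†T` and `S†S` is the square of that of `T†S`
  have hprod : ∀ j, T (v j) ≠ 0 → ∃ r : ℝ, S (v j) = (r : 𝕜) • T (v j) := by
    intro j hj
    have e : (μ j 0 * μ j 1) • v j = (μ j 2 * μ j 2) • v j := by
      have a1 : T.adjoint (T (v j)) = μ j 0 • v j := hμ j 0
      have a2 : S.adjoint (S (v j)) = μ j 1 • v j := hμ j 1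
      have a3 : T.adjoint (S (v j)) = μ j 2 • v j := hμ j 2
      calc (μ j 0 * μ j 1) • v j = T.adjoint (T (S.adjoint (S (v j)))) := by
            rw [a2, map_smul, map_smul, a1, smul_smul, mul_comm]
        _ = T.adjoint (S (T.adjoint (S (v j)))) := by rw [h₁']
        _ = _ := by rw [a3, map_smul, map_smul, a3, smul_smul]
    have e' : μ j 0 * μ j 1 = μ j 2 * μ j 2 := by
      have hvj : v j ≠ 0 := v.orthonormal.ne_zero j
      exact smul_left_injective 𝕜 hvj e
    have t0 : inner 𝕜 (T (v j)) (T (v j)) = μ j 0 := by rw [hTT, hvv, mul_one]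
    have s0 : inner 𝕜 (S (v j)) (S (v j)) = μ j 1 := by rw [hSS, hvv, mul_one]
    have x0 : inner 𝕜 (T (v j)) (S (v j)) = μ j 2 := by rw [hTS, hvv, mul_one]
    have x1 : inner 𝕜 (S (v j)) (T (v j)) = μ j 2 := by
      rw [← x0, ← LinearMap.adjoint_inner_right, ← h₂', LinearMap.adjoint_inner_right]
    have hreal : ((RCLike.re (μ j 2) : ℝ) : 𝕜) = μ j 2 := by
      rw [← RCLike.conj_eq_iff_re, ← x0, inner_conj_symm, x1, x0]
    have h0 : μ j 0 ≠ 0 := by rwa [← t0, inner_self_ne_zero]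
    have h0r : ((RCLike.re (μ j 0) : ℝ) : 𝕜) = μ j 0 := by
      rw [← RCLike.conj_eq_iff_re, ← t0, inner_conj_symm]
    refine ⟨RCLike.re (μ j 2) / RCLike.re (μ j 0), ?_⟩
    -- The equality case of Cauchy–Schwarz: the squared norm of the difference is `μ₁ - μ₂² / μ₀ =
    -- 0`.
    rw [← sub_eq_zero, ← inner_self_eq_zero (𝕜 := 𝕜)]
    rw [RCLike.ofReal_div, hreal, h0r]
    have hc : (starRingEnd 𝕜) (μ j 2 / μ j 0) = μ j 2 / μ j 0 := by
      rw [map_div₀, RCLike.conj_eq_iff_re.2 hreal, RCLike.conj_eq_iff_re.2 h0r]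
    rw [inner_sub_left, inner_sub_right, inner_sub_right, inner_smul_left, inner_smul_left,
      inner_smul_right, inner_smul_right, hc, t0, s0, x0, x1]
    field_simp
    linear_combination e'
  have key : ∀ j, ∃ (u : F) (a b : ℝ), 0 ≤ a ∧ (a = 0 → 0 ≤ b) ∧ T (v j) = (a : 𝕜) • u ∧
      S (v j) = (b : 𝕜) • u ∧ (‖u‖ = 1 ∨ (u = 0 ∧ a = 0 ∧ b = 0)) ∧ (u ≠ 0 → a ≠ 0 ∨ b ≠ 0) ∧
      (u ∈ Submodule.span 𝕜 {T (v j), S (v j)}) := by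
    intro j
    -- The vector `u` is the normalized `T (v j)`, or the normalized `S (v j)` if that vanishes, or
    -- zero if both do. A negative `b` can thus occur only when `a > 0`.
    by_cases hj : T (v j) = 0
    · by_cases hs : S (v j) = 0
      · exact ⟨0, 0, 0, by simp [hj, hs]⟩
      · have hns : (‖S (v j)‖ : 𝕜) ≠ 0 := by simpa using hs
        refine ⟨(‖S (v j)‖⁻¹ : 𝕜) • S (v j), 0, ‖S (v j)‖, le_rfl, fun _ => norm_nonneg _,
          by simp [hj], ?_, Or.inl ?_, fun _ => Or.inr (by simpa using hs), ?_⟩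
        · rw [smul_smul, mul_inv_cancel₀ hns, one_smul]
        · exact norm_smul_inv_norm hs
        · exact Submodule.smul_mem _ _ (Submodule.subset_span (by simp))
    · obtain ⟨r, hr⟩ := hprod j hj
      have hnt : (‖T (v j)‖ : 𝕜) ≠ 0 := by simpa using hj
      refine ⟨(‖T (v j)‖⁻¹ : 𝕜) • T (v j), ‖T (v j)‖, r * ‖T (v j)‖, norm_nonneg _, fun h => ?_,
        ?_, ?_, Or.inl (norm_smul_inv_norm hj), fun _ => Or.inl (by simpa using hj), ?_⟩
      · exact absurd (norm_eq_zero.1 h) hj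
      · rw [smul_smul, mul_inv_cancel₀ hnt, one_smul]
      · rw [hr, smul_smul]
        push_cast
        rw [mul_assoc, mul_inv_cancel₀ hnt, mul_one]
      · exact Submodule.smul_mem _ _ (Submodule.subset_span (by simp))
  choose u a b k₁ k₂ k₃ k₄ k₅ k₆ k₇ using key
  refine ⟨v, u, a, b, k₁, k₂, k₃, k₄, fun j k hjk => ?_, k₅, k₆⟩
  obtain ⟨x, y, hxy⟩ := Submodule.mem_span_pair.1 (k₇ j)
  obtain ⟨z, w, hzw⟩ := Submodule.mem_span_pair.1 (k₇ k)
  have hST : inner 𝕜 (S (v j)) (T (v k)) = (0 : 𝕜) := by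
    rw [← inner_conj_symm, hTS, hvo k j hjk.symm]; simp
  rw [← hxy, ← hzw]
  simp only [inner_add_left, inner_add_right, inner_smul_left, inner_smul_right, hTT, hSS, hTS,
    hST, hvo j k hjk]
  simp

/-- Singular values from an orthonormal eigenbasis of `T† T` in nonincreasing order. -/
theorem singularValues_eq_of_antitone {n : ℕ} (T : E →ₗ[𝕜] F)
    (v : OrthonormalBasis (Fin n) 𝕜 E) {a : Fin n → ℝ} (ha : ∀ j, 0 ≤ a j) (hanti : Antitone a)
    (hT : ∀ j, T.adjoint (T (v j)) = ((a j ^ 2 : ℝ) : 𝕜) • v j) (j : Fin n) :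
    T.singularValues j = a j := by
  have hn : finrank 𝕜 E = n := by simpa using finrank_eq_card_basis v.toBasis
  have hsym := T.isSymmetric_adjoint_comp_self
  -- In the basis `v` the operator is diagonal, so its characteristic roots are the `a j ^ 2`. The
  -- eigenvalues are the sorted roots, and this list is already sorted.
  have hmat : LinearMap.toMatrix v.toBasis v.toBasis (T.adjoint ∘ₗ T) =
      Matrix.diagonal fun j => ((a j ^ 2 : ℝ) : 𝕜) := by
    ext i k
    rw [LinearMap.toMatrix_apply, OrthonormalBasis.coe_toBasis, LinearMap.comp_apply, hT,
      OrthonormalBasis.coe_toBasis_repr_apply, map_smul]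
    by_cases h : i = k <;> simp [h, v.repr_self]
  have hroots : (T.adjoint ∘ₗ T).charpoly.roots =
      Multiset.map (fun j => ((a j ^ 2 : ℝ) : 𝕜)) Finset.univ.val := by
    rw [← LinearMap.charpoly_toMatrix _ v.toBasis, hmat, Matrix.charpoly_diagonal,
      Polynomial.roots_prod _ _
        (Finset.prod_ne_zero_iff.2 fun _ _ => Polynomial.X_sub_C_ne_zero _)]
    simp only [Polynomial.roots_X_sub_C, Multiset.bind_singleton]
  have hs := hsym.sort_roots_charpoly_eq_eigenvalues hn
  have hanti2 : Antitone fun j => a j ^ 2 := fun i j h => pow_le_pow_left₀ (ha j) (hanti h) 2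
  have hs' : ((T.adjoint ∘ₗ T).charpoly.roots.map RCLike.re).sort (· ≥ ·) =
      List.ofFn fun j => a j ^ 2 := by
    rw [hroots]
    simp only [Fin.univ_val_map, Multiset.map_coe, List.map_ofFn, Function.comp_def,
      RCLike.ofReal_re, Multiset.coe_sort]
    refine List.mergeSort_of_pairwise ?_
    simp_rw [decide_eq_true_eq, ← List.sortedGE_iff_pairwise]
    exact hanti2.sortedGE_ofFn
  have heq : hsym.eigenvalues hn = fun j => a j ^ 2 := List.ofFn_inj.1 (hs.symm.trans hs')
  rw [T.singularValues_fin hn, heq, Real.sqrt_sq (ha j)]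

/-- A permutation sorting a finite family in nonincreasing order. -/
lemma exists_perm_antitone {n : ℕ} (f : Fin n → ℝ) :
    ∃ τ : Equiv.Perm (Fin n), Antitone (f ∘ τ) := by
  refine ⟨Tuple.sort fun j => -f j, fun i j h => ?_⟩
  have := Tuple.monotone_sort (fun j => -f j) h
  simpa using this

theorem exists_perm_singularValues {n : ℕ} (T : E →ₗ[𝕜] F)
    (v : OrthonormalBasis (Fin n) 𝕜 E) {a : Fin n → ℝ} (ha : ∀ j, 0 ≤ a j)
    (hT : ∀ j, T.adjoint (T (v j)) = ((a j ^ 2 : ℝ) : 𝕜) • v j) :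
    ∃ π : Equiv.Perm (Fin n), ∀ j, a j = T.singularValues (π j) := by
  obtain ⟨τ, hτ⟩ := exists_perm_antitone a
  refine ⟨τ.symm, fun j => ?_⟩
  rw [singularValues_eq_of_antitone T (v.reindex τ.symm) (a := a ∘ τ) (fun j => ha _) hτ
    (fun j => by simpa using hT (τ j))]
  simp

/-- Monovarying families are sorted in nonincreasing order by a common permutation. -/
lemma exists_perm_antitone_of_monovary {n : ℕ} {f g : Fin n → ℝ} (h : Monovary f g) :
    ∃ τ : Equiv.Perm (Fin n), Antitone (f ∘ τ) ∧ Antitone (g ∘ τ) := by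
  -- Sorting the sum sorts both: a strict increase of one family forces a weak increase of the
  -- other, hence a strict increase of the sum.
  obtain ⟨τ, hτ⟩ := exists_perm_antitone fun j => f j + g j
  refine ⟨τ, fun i j hij => ?_, fun i j hij => ?_⟩
  · by_contra! hlt
    have h1 := h.symm hlt
    have h2 := hτ hij
    simp only [Function.comp_apply] at *
    linarith
  · by_contra! hlt
    have h1 := h hlt
    have h2 := hτ hij
    simp only [Function.comp_apply] at *
    linarith

lemma adjoint_apply_of_scaled {n : ℕ} {T : E →ₗ[𝕜] F} {v : OrthonormalBasis (Fin n) 𝕜 E}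
    {u : Fin n → F} {a : Fin n → ℝ} (hT : ∀ j, T (v j) = (a j : 𝕜) • u j)
    (ho : ∀ j k, j ≠ k → inner 𝕜 (u j) (u k) = 0) (hu : ∀ j, ‖u j‖ = 1 ∨ a j = 0) (j : Fin n) :
    T.adjoint (T (v j)) = ((a j ^ 2 : ℝ) : 𝕜) • v j := by
  refine InnerProductSpace.ext_inner_left_basis v.toBasis fun k => ?_
  rw [OrthonormalBasis.coe_toBasis, LinearMap.adjoint_inner_right, hT, hT, inner_smul_left,
    inner_smul_right, inner_smul_right]
  by_cases h : k = j
  · subst h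
    rcases hu k with h | h
    · rw [inner_self_eq_norm_sq_to_K, inner_self_eq_norm_sq_to_K, h, v.orthonormal.1 k]
      simp [pow_two]
    · simp [h]
  · rw [ho k j h, v.orthonormal.2 h]
    simp

/-- The rearrangement inequality; reindexing by `π` leaves a single relative permutation. -/
lemma sum_singularValues_mul_perm_le {n : ℕ} (T S : E →ₗ[𝕜] F) (π π' : Equiv.Perm (Fin n)) :
    ∑ j, T.singularValues (π j) * S.singularValues (π' j) ≤
      ∑ j : Fin n, T.singularValues j * S.singularValues j := by
  have hm : Monovary (fun j : Fin n => T.singularValues j) (fun j : Fin n => S.singularValues j) :=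
    fun i j h => T.singularValues_antitone (not_lt.1 fun hlt =>
      h.not_ge (S.singularValues_antitone hlt.le))
  rw [← Equiv.sum_comp π fun j : Fin n => T.singularValues j * S.singularValues j]
  have := hm.sum_mul_comp_perm_le_sum_mul (σ := π.symm.trans π')
  rw [← Equiv.sum_comp π, ← Equiv.sum_comp π fun i : Fin n =>
    T.singularValues i * S.singularValues i] at this
  simpa using this

lemma monovary_of_sum_singularValues_eq {n : ℕ} (T S : E →ₗ[𝕜] F) (π π' : Equiv.Perm (Fin n))
    (h : ∑ j, T.singularValues (π j) * S.singularValues (π' j) =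
      ∑ j : Fin n, T.singularValues j * S.singularValues j) :
    Monovary (fun j => T.singularValues (π j)) (fun j => S.singularValues (π' j)) := by
  have hm : Monovary (fun j : Fin n => T.singularValues j) (fun j : Fin n => S.singularValues j) :=
    fun i j h => T.singularValues_antitone (not_lt.1 fun hlt =>
      h.not_ge (S.singularValues_antitone hlt.le))
  have := hm.sum_mul_comp_perm_eq_sum_mul_iff (σ := π.symm.trans π')
  rw [← Equiv.sum_comp π, ← Equiv.sum_comp π fun i : Fin n =>
    T.singularValues i * S.singularValues i] at this
  have h' := this.1 (by
    rw [Equiv.sum_comp π fun i : Fin n => T.singularValues i * S.singularValues i]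
    simpa using h)
  have h'' := h'.comp_right π
  simpa [Function.comp_def] using h''

lemma re_trace_adjoint_comp {n : ℕ} {T S : E →ₗ[𝕜] F} {v : OrthonormalBasis (Fin n) 𝕜 E}
    {u : Fin n → F} {a b : Fin n → ℝ} (hT : ∀ j, T (v j) = (a j : 𝕜) • u j)
    (hS : ∀ j, S (v j) = (b j : 𝕜) • u j) (hu : ∀ j, ‖u j‖ = 1 ∨ a j = 0) :
    RCLike.re (LinearMap.trace 𝕜 E (T.adjoint ∘ₗ S)) = ∑ j, a j * b j := by
  rw [LinearMap.trace_eq_sum_inner _ v, map_sum]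
  refine Finset.sum_congr rfl fun j _ => ?_
  rw [LinearMap.comp_apply, LinearMap.adjoint_inner_right, hT, hS, inner_smul_left,
    inner_smul_right]
  rcases hu j with h | h
  · rw [inner_self_eq_norm_sq_to_K, h]
    simp
  · simp [h]

/-- **Von Neumann's trace inequality** at a critical pair. -/
theorem re_trace_le_of_comm {n : ℕ} (hn : finrank 𝕜 E = n) (T S : E →ₗ[𝕜] F)
    (h₁ : T ∘ₗ S.adjoint = S ∘ₗ T.adjoint) (h₂ : T.adjoint ∘ₗ S = S.adjoint ∘ₗ T) :
    RCLike.re (LinearMap.trace 𝕜 E (T.adjoint ∘ₗ S)) ≤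
      ∑ j : Fin n, T.singularValues j * S.singularValues j := by
  obtain ⟨v, u, a, b, ha, hb, hT, hS, ho, hu, -⟩ := exists_common_signed_svd hn T S h₁ h₂
  rw [re_trace_adjoint_comp hT hS fun j => (hu j).imp id fun h => h.2.1]
  obtain ⟨π, hπ⟩ := exists_perm_singularValues T v ha
    (adjoint_apply_of_scaled hT ho fun j => (hu j).imp id fun h => h.2.1)
  obtain ⟨π', hπ'⟩ := exists_perm_singularValues S v (fun j => abs_nonneg (b j))
    (fun j => by
      rw [sq_abs]
      exact adjoint_apply_of_scaled hS ho (fun i => (hu i).imp id fun h => h.2.2) j)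
  calc ∑ j, a j * b j ≤ ∑ j, a j * |b j| :=
        Finset.sum_le_sum fun j _ => mul_le_mul_of_nonneg_left (le_abs_self _) (ha j)
    _ = ∑ j, T.singularValues (π j) * S.singularValues (π' j) := by simp_rw [hπ, hπ']
    _ ≤ _ := sum_singularValues_mul_perm_le T S π π'

/-- The equality case of von Neumann's trace inequality at a critical pair: a common singular
value decomposition. -/
theorem exists_common_svd {m n : ℕ} (hn : finrank 𝕜 E = n) (hm : finrank 𝕜 F = m)
    (T S : E →ₗ[𝕜] F)
    (h₁ : T ∘ₗ S.adjoint = S ∘ₗ T.adjoint) (h₂ : T.adjoint ∘ₗ S = S.adjoint ∘ₗ T)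
    (heq : RCLike.re (LinearMap.trace 𝕜 E (T.adjoint ∘ₗ S)) =
      ∑ j : Fin n, T.singularValues j * S.singularValues j) :
    ∃ (v : OrthonormalBasis (Fin n) 𝕜 E) (u : OrthonormalBasis (Fin m) 𝕜 F),
      (∀ j : Fin n, T (v j) =
        (T.singularValues j : 𝕜) • if h : (j : ℕ) < m then u ⟨j, h⟩ else 0) ∧
      (∀ j : Fin n, S (v j) =
        (S.singularValues j : 𝕜) • if h : (j : ℕ) < m then u ⟨j, h⟩ else 0) := by
  obtain ⟨v, u, a, b, ha, hb, hT, hS, ho, hu, hne⟩ := exists_common_signed_svd hn T S h₁ h₂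
  rw [re_trace_adjoint_comp hT hS fun j => (hu j).imp id fun h => h.2.1] at heq
  obtain ⟨π, hπ⟩ := exists_perm_singularValues T v ha
    (adjoint_apply_of_scaled hT ho fun j => (hu j).imp id fun h => h.2.1)
  obtain ⟨π', hπ'⟩ := exists_perm_singularValues S v (fun j => abs_nonneg (b j))
    (fun j => by
      rw [sq_abs]
      exact adjoint_apply_of_scaled hS ho (fun i => (hu i).imp id fun h => h.2.2) j)
  have i₁ : ∀ j ∈ Finset.univ, a j * b j ≤ a j * |b j| :=
    fun j _ => mul_le_mul_of_nonneg_left (le_abs_self _) (ha j)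
  have i₂ : ∑ j, a j * |b j| = ∑ j, T.singularValues (π j) * S.singularValues (π' j) := by
    simp_rw [hπ, hπ']
  have i₃ := sum_singularValues_mul_perm_le T S π π'
  have i₄ : ∑ j, a j * b j = ∑ j, a j * |b j| :=
    le_antisymm (Finset.sum_le_sum i₁) (by rw [heq, i₂]; exact i₃)
  -- Equality leaves no room in `a j * b j ≤ a j * |b j|`, which fixes the sign where `a j > 0`;
  -- elsewhere it is part of the signed decomposition.
  have hb' : ∀ j, 0 ≤ b j := by
    intro j
    rcases (ha j).eq_or_lt with h | h
    · exact hb j h.symm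
    · have := (Finset.sum_eq_sum_iff_of_le i₁).1 i₄ j (Finset.mem_univ j)
      have := mul_left_cancel₀ h.ne' this
      rw [this]
      exact abs_nonneg _
  have hmono : Monovary a b := by
    have := monovary_of_sum_singularValues_eq T S π π' (by rw [← i₂, ← i₄, heq])
    have e₁ : (fun j => T.singularValues (π j)) = a := funext fun j => (hπ j).symm
    have e₂ : (fun j => S.singularValues (π' j)) = b :=
      funext fun j => by rw [← hπ', abs_of_nonneg (hb' j)]
    rwa [e₁, e₂] at this
  obtain ⟨τ, hτa, hτb⟩ := exists_perm_antitone_of_monovary hmono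
  have hadjT := adjoint_apply_of_scaled hT ho fun j => (hu j).imp id fun h => h.2.1
  have hadjS := adjoint_apply_of_scaled hS ho fun j => (hu j).imp id fun h => h.2.2
  have sT : ∀ j : Fin n, T.singularValues j = a (τ j) :=
    singularValues_eq_of_antitone T (v.reindex τ.symm) (a := a ∘ τ) (fun j => ha _) hτa
      (fun j => by simpa using hadjT (τ j))
  have sS : ∀ j : Fin n, S.singularValues j = b (τ j) :=
    singularValues_eq_of_antitone S (v.reindex τ.symm) (a := b ∘ τ) (fun j => hb' _) hτb
      (fun j => by simpa using hadjS (τ j))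
  have hzero : ∀ R : E →ₗ[𝕜] F, ∀ j, m ≤ j → R.singularValues j = 0 := by
    intro R j hj
    rw [R.singularValues_eq_zero_iff_le_finrank_range]
    exact (Submodule.finrank_le _).trans (hm.trans_le hj)
  -- The sorted singular vectors, cut or padded with zeros to length `m`. The nonzero ones are
  -- orthonormal and extend to a basis without changing their positions.
  let u' : Fin m → F := fun i => if h : (i : ℕ) < n then u (τ ⟨i, h⟩) else 0
  let s : Set (Fin m) := {i | u' i ≠ 0}
  have hon : Orthonormal 𝕜 (s.domRestrict u') := by
    constructor
    · rintro ⟨i, hi⟩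
      change ‖u' i‖ = 1
      have hi' : u' i ≠ 0 := hi
      simp only [u'] at hi' ⊢
      split_ifs with h
      · rw [dif_pos h] at hi'
        exact (hu _).resolve_right fun h' => hi' h'.1
      · rw [dif_neg h] at hi'
        exact absurd rfl hi'
    · rintro ⟨i, hi⟩ ⟨k, hk⟩ hik
      change inner 𝕜 (u' i) (u' k) = 0
      simp only [u']
      split_ifs with h1 h2
      · refine ho _ _ fun h => hik ?_
        have := Fin.mk.inj_iff.1 (τ.injective h)
        exact Subtype.ext (Fin.ext this)
      all_goals simp
  obtain ⟨ub, hub⟩ := hon.exists_orthonormalBasis_extension_of_card_eq (by simpa using hm)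
  have hcol : ∀ j : Fin n, u (τ j) ≠ 0 →
      (if h : (j : ℕ) < m then ub ⟨j, h⟩ else 0) = u (τ j) := by
    intro j hj
    -- A nonzero `u` carries a nonzero singular value of `T` or `S`, and these vanish from index `m`
    -- on, so truncation loses nothing.
    have hjm : (j : ℕ) < m := by
      by_contra! hle
      rcases hne _ hj with h | h
      · exact h (by rw [← sT, hzero T j hle])
      · exact h (by rw [← sS, hzero S j hle])
    rw [dif_pos hjm]
    have e : u' ⟨j, hjm⟩ = u (τ j) := by simp [u']
    rw [hub _ (show u' ⟨j, hjm⟩ ≠ 0 by rwa [e]), e]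
  refine ⟨v.reindex τ.symm, ub, fun j => ?_, fun j => ?_⟩
  · have : (v.reindex τ.symm) j = v (τ j) := by simp
    rw [this, hT, sT]
    by_cases hj : u (τ j) = 0
    · have h0 := ((hu (τ j)).resolve_left (by simp [hj])).2.1
      simp [h0]
    · rw [hcol j hj]
  · have : (v.reindex τ.symm) j = v (τ j) := by simp
    rw [this, hS, sS]
    by_cases hj : u (τ j) = 0
    · have h0 := ((hu (τ j)).resolve_left (by simp [hj])).2.2
      simp [h0]
    · rw [hcol j hj]

end CommonSVD

/-! ### Von Neumann's trace inequality and Mirsky's inequality for matrices -/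

section MatrixSVD

open Module

variable {𝕜 : Type*} [RCLike 𝕜] {m n : ℕ}

lemma re_trace_conjTranspose_mul_self (A : Matrix (Fin m) (Fin n) 𝕜) :
    RCLike.re (Aᴴ * A).trace = ∑ a, ∑ b, ‖A a b‖ ^ 2 := by
  rw [Finset.sum_comm]
  simp only [Matrix.trace, Matrix.diag_apply, Matrix.mul_apply, Matrix.conjTranspose_apply,
    map_sum]
  refine Finset.sum_congr rfl fun b _ => Finset.sum_congr rfl fun a _ => ?_
  rw [RCLike.star_def, RCLike.conj_mul, ← RCLike.ofReal_pow, RCLike.ofReal_re]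

lemma re_trace_conjTranspose (A : Matrix (Fin n) (Fin n) 𝕜) :
    RCLike.re Aᴴ.trace = RCLike.re A.trace := by
  rw [Matrix.trace_conjTranspose, RCLike.star_def, RCLike.conj_re]

section Critical
open scoped Matrix.Norms.Frobenius

/-- A square matrix `M` at which `U ↦ Re tr (U M)` is maximal at `U = 1` over the unitary group is
Hermitian. -/
theorem conjTranspose_eq_of_forall_re_trace_le (M : Matrix (Fin n) (Fin n) 𝕜)
    (h : ∀ U ∈ Matrix.unitaryGroup (Fin n) 𝕜, RCLike.re (U * M).trace ≤ RCLike.re M.trace) :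
    Mᴴ = M := by
  -- Along the unitary curve `exp (t K)` the derivative at `0` is `Re tr (K M)`, which is half of
  -- `‖K‖²`; maximality makes it zero.
  set K := Mᴴ - M with hK
  have hskew : Kᴴ = -K := by
    rw [hK, Matrix.conjTranspose_sub, Matrix.conjTranspose_conjTranspose, neg_sub]
  let φ : Matrix (Fin n) (Fin n) 𝕜 →ₗ[ℝ] ℝ :=
    { toFun := fun X => RCLike.re (X * M).trace
      map_add' := fun X Y => by rw [Matrix.add_mul, Matrix.trace_add, map_add]
      map_smul' := fun r X => by
        rw [Matrix.smul_mul, Matrix.trace_smul, RCLike.smul_re]; simp }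
  have hd : HasDerivAt (fun t : ℝ => φ (NormedSpace.exp (t • K))) (φ K) 0 := by
    have h1 := hasDerivAt_exp_smul_const (𝕂 := ℝ) K (0 : ℝ)
    rw [zero_smul, NormedSpace.exp_zero, one_mul] at h1
    exact (LinearMap.toContinuousLinearMap φ).hasFDerivAt.comp_hasDerivAt (0 : ℝ) h1
  have hmax : IsLocalMax (fun t : ℝ => φ (NormedSpace.exp (t • K))) 0 := by
    refine Filter.Eventually.of_forall fun t => ?_
    have hu : NormedSpace.exp (t • K) ∈ Matrix.unitaryGroup (Fin n) 𝕜 :=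
      NormedSpace.exp_mem_unitary_of_mem_skewAdjoint
        (skewAdjoint.smul_mem t (skewAdjoint.mem_iff.2 hskew))
    have := h _ hu
    simpa [φ] using this
  have h0 : RCLike.re (K * M).trace = 0 := hmax.hasDerivAt_eq_zero hd
  have h1 : RCLike.re (Kᴴ * K).trace = 0 := by
    have e1 : RCLike.re (K * Mᴴ).trace = -RCLike.re (K * M).trace := by
      rw [← re_trace_conjTranspose, Matrix.conjTranspose_mul, Matrix.conjTranspose_conjTranspose,
        hskew, Matrix.trace_mul_comm, Matrix.neg_mul, Matrix.trace_neg, map_neg]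
    rw [hskew, Matrix.neg_mul, Matrix.trace_neg, map_neg]
    nth_rewrite 2 [hK]
    rw [Matrix.mul_sub, Matrix.trace_sub, map_sub, e1, h0]
    simp
  have : K = 0 := by
    rw [re_trace_conjTranspose_mul_self,
      Finset.sum_eq_zero_iff_of_nonneg fun _ _ => Finset.sum_nonneg fun _ _ => by positivity] at h1
    ext a b
    have h2 := h1 a (Finset.mem_univ a)
    rw [Finset.sum_eq_zero_iff_of_nonneg fun _ _ => by positivity] at h2
    simpa using h2 b (Finset.mem_univ b)
  exact sub_eq_zero.1 this

end Critical

lemma conjTranspose_mem_unitaryGroup {U : Matrix (Fin n) (Fin n) 𝕜}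
    (hU : U ∈ Matrix.unitaryGroup (Fin n) 𝕜) : Uᴴ ∈ Matrix.unitaryGroup (Fin n) 𝕜 := by
  rw [Matrix.mem_unitaryGroup_iff', Matrix.star_eq_conjTranspose,
    Matrix.conjTranspose_conjTranspose]
  exact Matrix.mem_unitaryGroup_iff.1 hU

/-- Unitary matrices form a closed set with entries in the unit ball, so compactness follows in the
product topology. -/
lemma isCompact_unitaryGroup :
    IsCompact {U : Matrix (Fin n) (Fin n) 𝕜 | U ∈ Matrix.unitaryGroup (Fin n) 𝕜} := by
  have hb : IsCompact (Set.univ.pi fun _ : Fin n => Set.univ.pi fun _ : Fin n =>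
      Metric.closedBall (0 : 𝕜) 1) :=
    isCompact_univ_pi fun _ => isCompact_univ_pi fun _ => isCompact_closedBall (0 : 𝕜) 1
  have hcl : IsClosed {U : Matrix (Fin n) (Fin n) 𝕜 | U ∈ Matrix.unitaryGroup (Fin n) 𝕜} := by
    have : {U : Matrix (Fin n) (Fin n) 𝕜 | U ∈ Matrix.unitaryGroup (Fin n) 𝕜} =
        {U | U * Uᴴ = 1} := Set.ext fun U => Matrix.mem_unitaryGroup_iff
    rw [this]
    exact isClosed_eq (continuous_id.matrix_mul continuous_id.matrix_conjTranspose)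
      continuous_const
  refine IsCompact.of_isClosed_subset hb hcl fun U hU i _ j _ => ?_
  exact mem_closedBall_zero_iff.2 (entry_norm_bound_of_unitary hU i j)

theorem exists_isMax_re_trace (A B : Matrix (Fin m) (Fin n) 𝕜) :
    ∃ U₀ ∈ Matrix.unitaryGroup (Fin m) 𝕜, ∃ V₀ ∈ Matrix.unitaryGroup (Fin n) 𝕜,
      ∀ U ∈ Matrix.unitaryGroup (Fin m) 𝕜, ∀ V ∈ Matrix.unitaryGroup (Fin n) 𝕜,
        RCLike.re ((U * A * V)ᴴ * B).trace ≤ RCLike.re ((U₀ * A * V₀)ᴴ * B).trace := by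
  have hcont : Continuous fun p : Matrix (Fin m) (Fin m) 𝕜 × Matrix (Fin n) (Fin n) 𝕜 =>
      RCLike.re ((p.1 * A * p.2)ᴴ * B).trace :=
    RCLike.continuous_re.comp ((((continuous_fst.matrix_mul continuous_const).matrix_mul
      continuous_snd).matrix_conjTranspose.matrix_mul continuous_const).matrix_trace)
  have hne : ({U : Matrix (Fin m) (Fin m) 𝕜 | U ∈ Matrix.unitaryGroup (Fin m) 𝕜} ×ˢ
      {V : Matrix (Fin n) (Fin n) 𝕜 | V ∈ Matrix.unitaryGroup (Fin n) 𝕜}).Nonempty :=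
    Set.Nonempty.prod ⟨1, one_mem (Matrix.unitaryGroup (Fin m) 𝕜)⟩
      ⟨1, one_mem (Matrix.unitaryGroup (Fin n) 𝕜)⟩
  obtain ⟨p, hp, hmax⟩ := (isCompact_unitaryGroup.prod isCompact_unitaryGroup).exists_isMaxOn
    hne hcont.continuousOn
  refine ⟨p.1, hp.1, p.2, hp.2, fun U hU V hV => ?_⟩
  exact isMaxOn_iff.1 hmax (U, V) (Set.mk_mem_prod hU hV)

/-- If `(1, 1)` maximizes `(U, V) ↦ Re tr ((U A V)ᴴ B)` over pairs of unitary matrices, then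
`A Bᴴ` and `Aᴴ B` are Hermitian. -/
theorem comm_of_forall_re_trace_le {A B : Matrix (Fin m) (Fin n) 𝕜}
    (h : ∀ U ∈ Matrix.unitaryGroup (Fin m) 𝕜, ∀ V ∈ Matrix.unitaryGroup (Fin n) 𝕜,
      RCLike.re ((U * A * V)ᴴ * B).trace ≤ RCLike.re (Aᴴ * B).trace) :
    A * Bᴴ = B * Aᴴ ∧ Aᴴ * B = Bᴴ * A := by
  constructor
  · have := conjTranspose_eq_of_forall_re_trace_le (B * Aᴴ) fun U hU => by
      have h1 := h Uᴴ (conjTranspose_mem_unitaryGroup hU) 1 (one_mem _)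
      rw [Matrix.mul_one, Matrix.conjTranspose_mul, Matrix.conjTranspose_conjTranspose] at h1
      rwa [Matrix.trace_mul_comm, Matrix.mul_assoc, Matrix.trace_mul_comm B,
        Matrix.trace_mul_comm B]
    rw [← this, Matrix.conjTranspose_mul, Matrix.conjTranspose_conjTranspose]
  · have := conjTranspose_eq_of_forall_re_trace_le (Aᴴ * B) fun U hU => by
      have h1 := h 1 (one_mem _) Uᴴ (conjTranspose_mem_unitaryGroup hU)
      rwa [Matrix.one_mul, Matrix.conjTranspose_mul, Matrix.conjTranspose_conjTranspose,
        Matrix.mul_assoc] at h1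
    rw [← this, Matrix.conjTranspose_mul, Matrix.conjTranspose_conjTranspose]

/-- The sequence of singular values of a matrix. -/
noncomputable def sigma (A : Matrix (Fin m) (Fin n) 𝕜) (j : ℕ) : ℝ :=
  (Matrix.toEuclideanLin A).singularValues j

lemma sigma_nonneg (A : Matrix (Fin m) (Fin n) 𝕜) (j : ℕ) : 0 ≤ sigma A j :=
  LinearMap.singularValues_nonneg _ _

lemma sigma_antitone (A : Matrix (Fin m) (Fin n) 𝕜) : Antitone (sigma A) :=
  LinearMap.singularValues_antitone _

lemma sigma_of_ge (A : Matrix (Fin m) (Fin n) 𝕜) {j : ℕ} (hj : m ≤ j) : sigma A j = 0 := by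
  rw [sigma, LinearMap.singularValues_eq_zero_iff_le_finrank_range]
  exact (Submodule.finrank_le _).trans (by simpa using hj)

/-- Rectangular diagonal matrix. -/
def rectDiag (𝕜 : Type*) [RCLike 𝕜] (m n : ℕ) (s : ℕ → ℝ) : Matrix (Fin m) (Fin n) 𝕜 :=
  Matrix.of fun a b => if a.val = b.val then (s a.val : 𝕜) else 0

lemma rectDiag_congr {s t : ℕ → ℝ} (h : ∀ j < min m n, s j = t j) :
    rectDiag 𝕜 m n s = rectDiag 𝕜 m n t := by
  ext a b
  simp only [rectDiag, Matrix.of_apply]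
  split_ifs with hab
  · rw [h a (lt_min a.2 (hab ▸ b.2))]
  · rfl

lemma sum_fin_eq_sum_min {F : ℕ → ℝ} (hF : ∀ j, m ≤ j → F j = 0) :
    ∑ j : Fin n, F j = ∑ j : Fin (min m n), F j := by
  rw [Fin.sum_univ_eq_sum_range, Fin.sum_univ_eq_sum_range]
  refine (Finset.sum_subset (Finset.range_mono (min_le_right m n)) fun j hj hj' => hF j ?_).symm
  simp only [Finset.mem_range] at hj hj'
  omega

lemma conjTranspose_rectDiag_mul (s t : ℕ → ℝ) :
    (rectDiag 𝕜 m n s)ᴴ * rectDiag 𝕜 m n t =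
      Matrix.diagonal fun j : Fin n => if (j : ℕ) < m then ((s j * t j : ℝ) : 𝕜) else 0 := by
  ext i j
  simp only [Matrix.mul_apply, Matrix.conjTranspose_apply, rectDiag, Matrix.of_apply,
    Matrix.diagonal_apply]
  by_cases hi : (i : ℕ) < m
  · rw [Finset.sum_eq_single ⟨i, hi⟩]
    · by_cases hij : i = j
      · subst hij; simp [hi]
      · simp [hij, Fin.val_inj]
    · intro b _ hb
      have : (b : ℕ) ≠ i := fun h => hb (Fin.ext h)
      simp [this]
    · simp
  · rw [Finset.sum_eq_zero]
    · simp [hi]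
    · intro b _
      have : (b : ℕ) ≠ i := by omega
      simp [this]

lemma exists_orthonormalBasis_of_mem_unitaryGroup {V : Matrix (Fin n) (Fin n) 𝕜}
    (hV : V ∈ Matrix.unitaryGroup (Fin n) 𝕜) :
    ∃ v : OrthonormalBasis (Fin n) 𝕜 (EuclideanSpace 𝕜 (Fin n)), ∀ j x, v j x = V x j := by
  have hV' : Vᴴ * V = 1 := Matrix.mem_unitaryGroup_iff'.1 hV
  let f : Fin n → EuclideanSpace 𝕜 (Fin n) := fun j => WithLp.toLp 2 fun x => V x j
  have hf : Orthonormal 𝕜 f := by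
    rw [orthonormal_iff_ite]
    intro i j
    have := congrFun (congrFun hV' i) j
    rw [Matrix.mul_apply, Matrix.one_apply] at this
    rw [← this, PiLp.inner_apply]
    refine Finset.sum_congr rfl fun x _ => ?_
    simp [f, mul_comm]
  obtain ⟨v, hv⟩ := Orthonormal.exists_orthonormalBasis_extension_of_card_eq (v := f)
    (s := Set.univ) (by simp) (hf.comp _ Subtype.val_injective)
  exact ⟨v, fun j x => by rw [hv j trivial]⟩

/-- Singular values of `U D Vᴴ` with `D` rectangular diagonal. -/
theorem sigma_of_svd {A : Matrix (Fin m) (Fin n) 𝕜} {U : Matrix (Fin m) (Fin m) 𝕜}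
    {V : Matrix (Fin n) (Fin n) 𝕜} {s : ℕ → ℝ} (hU : U ∈ Matrix.unitaryGroup (Fin m) 𝕜)
    (hV : V ∈ Matrix.unitaryGroup (Fin n) 𝕜) (hs : ∀ j < min m n, 0 ≤ s j)
    (hanti : ∀ i j, i ≤ j → j < min m n → s j ≤ s i) (hA : A = U * rectDiag 𝕜 m n s * Vᴴ)
    (j : ℕ) (hj : j < min m n) : sigma A j = s j := by
  have hU' : Uᴴ * U = 1 := Matrix.mem_unitaryGroup_iff'.1 hU
  have hV' : Vᴴ * V = 1 := Matrix.mem_unitaryGroup_iff'.1 hV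
  obtain ⟨v, hv⟩ := exists_orthonormalBasis_of_mem_unitaryGroup hV
  set D := rectDiag 𝕜 m n s with hD
  -- The columns of `V` are eigenvectors of `AᴴA`. Below, the eigenvalue list is padded with zeros
  -- from index `m` on, which keeps it nonincreasing because `s` is nonnegative.
  have hAAV : Aᴴ * A * V = V * (Dᴴ * D) := by
    calc Aᴴ * A * V = V * Dᴴ * (Uᴴ * U) * D * (Vᴴ * V) := by
          rw [hA]
          simp only [Matrix.conjTranspose_mul, Matrix.conjTranspose_conjTranspose,
            Matrix.mul_assoc]
      _ = _ := by rw [hU', hV']; simp only [Matrix.mul_one, Matrix.mul_assoc]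
  have key := singularValues_eq_of_antitone (Matrix.toEuclideanLin A) v
    (a := fun j => if (j : ℕ) < m then s j else 0) (fun j => by
      split_ifs with h
      · exact hs _ (lt_min h j.2)
      · exact le_rfl)
    (fun i j hij => by
      dsimp only
      split_ifs with h1 h2 h2
      · exact hanti _ _ hij (lt_min h1 j.2)
      · exact absurd (lt_of_le_of_lt (Fin.le_def.1 hij) h1) h2
      · exact hs _ (lt_min h2 i.2)
      · exact le_rfl)
    (fun k => by
      rw [← Matrix.toEuclideanLin_conjTranspose_eq_adjoint]
      ext x
      rw [Matrix.ofLp_toLpLin, Matrix.ofLp_toLpLin, Matrix.toLin'_apply, Matrix.toLin'_apply,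
        Matrix.mulVec_mulVec]
      have e : (Aᴴ * A) *ᵥ (v k).ofLp = (Aᴴ * A * V).col k := by
        ext y
        simp only [Matrix.mulVec, dotProduct, Matrix.col_apply, Matrix.mul_apply (M := Aᴴ * A), hv]
      rw [e, hAAV, hD, conjTranspose_rectDiag_mul, Matrix.col_apply, Matrix.mul_diagonal,
        PiLp.smul_apply, hv, smul_eq_mul, mul_comm]
      split_ifs <;> simp [pow_two])
    ⟨j, hj.trans_le (min_le_right _ _)⟩
  rw [sigma, key]
  simp [hj.trans_le (min_le_left _ _)]

lemma toEuclideanLin_comp {k : ℕ} (A : Matrix (Fin m) (Fin n) 𝕜) (B : Matrix (Fin n) (Fin k) 𝕜) :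
    Matrix.toEuclideanLin (A * B) = Matrix.toEuclideanLin A ∘ₗ Matrix.toEuclideanLin B :=
  Matrix.toLpLin_mul _ _ _ _ _

lemma trace_adjoint_comp_toEuclideanLin (A B : Matrix (Fin m) (Fin n) 𝕜) :
    LinearMap.trace 𝕜 _ ((Matrix.toEuclideanLin A).adjoint ∘ₗ Matrix.toEuclideanLin B) =
      (Aᴴ * B).trace := by
  rw [← Matrix.toEuclideanLin_conjTranspose_eq_adjoint, ← toEuclideanLin_comp,
    Matrix.toEuclideanLin_eq_toLin_orthonormal, Matrix.trace_toLin_eq]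

lemma comm_toEuclideanLin {A B : Matrix (Fin m) (Fin n) 𝕜} (h₁ : A * Bᴴ = B * Aᴴ)
    (h₂ : Aᴴ * B = Bᴴ * A) :
    Matrix.toEuclideanLin A ∘ₗ (Matrix.toEuclideanLin B).adjoint =
        Matrix.toEuclideanLin B ∘ₗ (Matrix.toEuclideanLin A).adjoint ∧
      (Matrix.toEuclideanLin A).adjoint ∘ₗ Matrix.toEuclideanLin B =
        (Matrix.toEuclideanLin B).adjoint ∘ₗ Matrix.toEuclideanLin A := by
  rw [← Matrix.toEuclideanLin_conjTranspose_eq_adjoint,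
    ← Matrix.toEuclideanLin_conjTranspose_eq_adjoint, ← toEuclideanLin_comp,
    ← toEuclideanLin_comp, ← toEuclideanLin_comp, ← toEuclideanLin_comp, h₁, h₂]
  exact ⟨rfl, rfl⟩

theorem re_trace_conjTranspose_mul_self_eq_sum_sigma (A : Matrix (Fin m) (Fin n) 𝕜) :
    RCLike.re (Aᴴ * A).trace = ∑ j : Fin n, sigma A j * sigma A j := by
  have hn : finrank 𝕜 (EuclideanSpace 𝕜 (Fin n)) = n := by simp
  rw [← trace_adjoint_comp_toEuclideanLin,
    LinearMap.IsSymmetric.re_trace_eq_sum_eigenvalues hn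
      (Matrix.toEuclideanLin A).isSymmetric_adjoint_comp_self]
  refine Finset.sum_congr rfl fun j _ => ?_
  rw [← LinearMap.sq_singularValues_fin, pow_two]
  rfl

lemma toMatrix_mul_rectDiag_apply {A : Matrix (Fin m) (Fin n) 𝕜}
    {v : OrthonormalBasis (Fin n) 𝕜 (EuclideanSpace 𝕜 (Fin n))}
    {u : OrthonormalBasis (Fin m) 𝕜 (EuclideanSpace 𝕜 (Fin m))} {s : ℕ → ℝ}
    (h : ∀ j : Fin n, Matrix.toEuclideanLin A (v j) =
      (s j : 𝕜) • if h : (j : ℕ) < m then u ⟨j, h⟩ else 0)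
    {U : Matrix (Fin m) (Fin m) 𝕜} {V : Matrix (Fin n) (Fin n) 𝕜} (hV : V * Vᴴ = 1)
    (hUu : ∀ x i, U x i = u i x) (hVv : ∀ x j, V x j = v j x) :
    A = U * rectDiag 𝕜 m n s * Vᴴ := by
  have : A * V = U * rectDiag 𝕜 m n s := by
    ext x j
    have hx := congrArg (fun z : EuclideanSpace 𝕜 (Fin m) => z x) (h j)
    dsimp only at hx
    rw [Matrix.ofLp_toLpLin, Matrix.toLin'_apply] at hx
    have e : (A *ᵥ (v j).ofLp) x = (A * V) x j := by
      simp [Matrix.mulVec, dotProduct, Matrix.mul_apply, hVv]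
    rw [← e, hx, PiLp.smul_apply, Matrix.mul_apply]
    simp only [rectDiag, Matrix.of_apply, hUu]
    split_ifs with hj
    · rw [Finset.sum_eq_single ⟨j, hj⟩]
      · simp [mul_comm]
      · intro b _ hb
        have : (b : ℕ) ≠ j := fun h => hb (Fin.ext h)
        simp [this]
      · simp
    · rw [Finset.sum_eq_zero]
      · simp
      · intro b _
        have : (b : ℕ) ≠ j := by omega
        simp [this]
  rw [← this, Matrix.mul_assoc, hV, Matrix.mul_one]

theorem exists_common_matrix_svd {A B : Matrix (Fin m) (Fin n) 𝕜} (h₁ : A * Bᴴ = B * Aᴴ)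
    (h₂ : Aᴴ * B = Bᴴ * A)
    (heq : RCLike.re (Aᴴ * B).trace = ∑ j : Fin n, sigma A j * sigma B j) :
    ∃ U ∈ Matrix.unitaryGroup (Fin m) 𝕜, ∃ V ∈ Matrix.unitaryGroup (Fin n) 𝕜,
      A = U * rectDiag 𝕜 m n (sigma A) * Vᴴ ∧ B = U * rectDiag 𝕜 m n (sigma B) * Vᴴ := by
  obtain ⟨c₁, c₂⟩ := comm_toEuclideanLin h₁ h₂
  obtain ⟨v, u, hvA, hvB⟩ := exists_common_svd (m := m) (n := n) (by simp) (by simp) _ _ c₁ c₂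
    (by rw [trace_adjoint_comp_toEuclideanLin, heq]; rfl)
  have hU := (EuclideanSpace.basisFun (Fin m) 𝕜).toMatrix_orthonormalBasis_mem_unitary u
  have hV := (EuclideanSpace.basisFun (Fin n) 𝕜).toMatrix_orthonormalBasis_mem_unitary v
  refine ⟨_, hU, _, hV, ?_, ?_⟩
  · exact toMatrix_mul_rectDiag_apply hvA (Matrix.mem_unitaryGroup_iff.1 hV)
      (fun x i => rfl) (fun x j => rfl)
  · exact toMatrix_mul_rectDiag_apply hvB (Matrix.mem_unitaryGroup_iff.1 hV)
      (fun x i => rfl) (fun x j => rfl)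

/-- Existence of singular value decompositions. -/
theorem exists_matrix_svd (A : Matrix (Fin m) (Fin n) 𝕜) :
    ∃ U ∈ Matrix.unitaryGroup (Fin m) 𝕜, ∃ V ∈ Matrix.unitaryGroup (Fin n) 𝕜,
      A = U * rectDiag 𝕜 m n (sigma A) * Vᴴ := by
  -- For `B = A` both symmetry conditions are trivial and `tr (AᴴA)` is the sum of the squared
  -- singular values, so this is the equality case.
  obtain ⟨U, hU, V, hV, h, -⟩ := exists_common_matrix_svd (A := A) (B := A) rfl rfl
    (re_trace_conjTranspose_mul_self_eq_sum_sigma A)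
  exact ⟨U, hU, V, hV, h⟩

lemma sigma_unitary_mul_mul (A : Matrix (Fin m) (Fin n) 𝕜) {U : Matrix (Fin m) (Fin m) 𝕜}
    {V : Matrix (Fin n) (Fin n) 𝕜} (hU : U ∈ Matrix.unitaryGroup (Fin m) 𝕜)
    (hV : V ∈ Matrix.unitaryGroup (Fin n) 𝕜) (j : Fin n) :
    sigma (U * A * V) j = sigma A j := by
  obtain ⟨U₁, hU₁, V₁, hV₁, h⟩ := exists_matrix_svd A
  rcases lt_or_ge (j : ℕ) m with hj | hj
  · refine sigma_of_svd (mul_mem hU hU₁) (mul_mem (conjTranspose_mem_unitaryGroup hV) hV₁) (fun j _ => sigma_nonneg A j)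
      (fun i j hij _ => sigma_antitone A hij) ?_ j (lt_min hj j.2)
    rw [Matrix.conjTranspose_mul, Matrix.conjTranspose_conjTranspose]
    nth_rewrite 1 [h]
    simp only [Matrix.mul_assoc]
  · rw [sigma_of_ge _ hj, sigma_of_ge _ hj]

/-- **Von Neumann's trace inequality.** -/
theorem re_trace_le_sum_sigma (A B : Matrix (Fin m) (Fin n) 𝕜) :
    RCLike.re (Aᴴ * B).trace ≤ ∑ j : Fin n, sigma A j * sigma B j := by
  obtain ⟨U₀, hU₀, V₀, hV₀, hmax⟩ := exists_isMax_re_trace A B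
  -- Moving the maximizer into `A` puts the maximum at `(1, 1)`; the singular values are unchanged.
  obtain ⟨h₁, h₂⟩ := comm_of_forall_re_trace_le (A := U₀ * A * V₀) (B := B) fun U hU V hV => by
    have := hmax (U * U₀) (mul_mem hU hU₀) (V₀ * V) (mul_mem hV₀ hV)
    simpa only [Matrix.mul_assoc] using this
  obtain ⟨c₁, c₂⟩ := comm_toEuclideanLin h₁ h₂
  have h := re_trace_le_of_comm (n := n) (by simp) _ _ c₁ c₂
  rw [trace_adjoint_comp_toEuclideanLin] at h
  have h' := hmax 1 (one_mem _) 1 (one_mem _)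
  rw [Matrix.one_mul, Matrix.mul_one] at h'
  refine h'.trans (h.trans_eq (Finset.sum_congr rfl fun j _ => ?_))
  exact congrArg (· * _) (sigma_unitary_mul_mul A hU₀ hV₀ j)

/-- The equality case of von Neumann's trace inequality. -/
theorem exists_common_matrix_svd_of_re_trace_eq {A B : Matrix (Fin m) (Fin n) 𝕜}
    (heq : RCLike.re (Aᴴ * B).trace = ∑ j : Fin n, sigma A j * sigma B j) :
    ∃ U ∈ Matrix.unitaryGroup (Fin m) 𝕜, ∃ V ∈ Matrix.unitaryGroup (Fin n) 𝕜,
      A = U * rectDiag 𝕜 m n (sigma A) * Vᴴ ∧ B = U * rectDiag 𝕜 m n (sigma B) * Vᴴ := by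
  -- Equality in the bound means that `(1, 1)` is already a maximizer, so no rotation is needed.
  obtain ⟨h₁, h₂⟩ := comm_of_forall_re_trace_le (A := A) (B := B) fun U hU V hV => by
    rw [heq]
    refine (re_trace_le_sum_sigma (U * A * V) B).trans_eq (Finset.sum_congr rfl fun j _ => ?_)
    rw [sigma_unitary_mul_mul A hU hV]
  exact exists_common_matrix_svd h₁ h₂ heq

/-- Expanding the square shows that the deficit in Mirsky's inequality is twice the deficit in von
Neumann's, so both the inequality and its equality case transfer. -/
lemma sum_norm_sub_sq (A B : Matrix (Fin m) (Fin n) 𝕜) :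
    ∑ a, ∑ b, ‖A a b - B a b‖ ^ 2 = ∑ j : Fin (min m n), (sigma A j - sigma B j) ^ 2 +
      2 * (∑ j : Fin n, sigma A j * sigma B j - RCLike.re (Aᴴ * B).trace) := by
  have h := re_trace_conjTranspose_mul_self (A - B)
  simp only [Matrix.sub_apply] at h
  rw [← h, Matrix.conjTranspose_sub, Matrix.sub_mul, Matrix.mul_sub, Matrix.mul_sub,
    Matrix.trace_sub, Matrix.trace_sub, Matrix.trace_sub, map_sub, map_sub, map_sub,
    re_trace_conjTranspose_mul_self_eq_sum_sigma, re_trace_conjTranspose_mul_self_eq_sum_sigma,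
    ← re_trace_conjTranspose (Bᴴ * A), Matrix.conjTranspose_mul,
    Matrix.conjTranspose_conjTranspose,
    ← sum_fin_eq_sum_min (F := fun j => (sigma A j - sigma B j) ^ 2) fun j hj => by
      simp [sigma_of_ge _ hj]]
  simp only [sub_sq, Finset.sum_add_distrib, Finset.sum_sub_distrib, ← pow_two, mul_assoc,
    ← Finset.mul_sum]
  ring

/-- **Mirsky's inequality** for the Frobenius norm. -/
theorem sum_sq_sigma_sub_le (A B : Matrix (Fin m) (Fin n) 𝕜) :
    ∑ j : Fin (min m n), (sigma A j - sigma B j) ^ 2 ≤ ∑ a, ∑ b, ‖A a b - B a b‖ ^ 2 := by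
  rw [sum_norm_sub_sq]
  linarith [re_trace_le_sum_sigma A B]

/-- The equality case of Mirsky's inequality. -/
theorem exists_common_matrix_svd_of_sum_sq_eq {A B : Matrix (Fin m) (Fin n) 𝕜}
    (heq : ∑ a, ∑ b, ‖A a b - B a b‖ ^ 2 = ∑ j : Fin (min m n), (sigma A j - sigma B j) ^ 2) :
    ∃ U ∈ Matrix.unitaryGroup (Fin m) 𝕜, ∃ V ∈ Matrix.unitaryGroup (Fin n) 𝕜,
      A = U * rectDiag 𝕜 m n (sigma A) * Vᴴ ∧ B = U * rectDiag 𝕜 m n (sigma B) * Vᴴ := by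
  rw [sum_norm_sub_sq] at heq
  exact exists_common_matrix_svd_of_re_trace_eq (by linarith)

/-- Matrices with a common singular value decomposition attain equality in Mirsky's inequality. -/
theorem sum_norm_sub_sq_of_common_svd {A B : Matrix (Fin m) (Fin n) 𝕜}
    {U : Matrix (Fin m) (Fin m) 𝕜} {V : Matrix (Fin n) (Fin n) 𝕜}
    (hU : U ∈ Matrix.unitaryGroup (Fin m) 𝕜) (hV : V ∈ Matrix.unitaryGroup (Fin n) 𝕜)
    (hA : A = U * rectDiag 𝕜 m n (sigma A) * Vᴴ) (hB : B = U * rectDiag 𝕜 m n (sigma B) * Vᴴ) :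
    ∑ a, ∑ b, ‖A a b - B a b‖ ^ 2 = ∑ j : Fin (min m n), (sigma A j - sigma B j) ^ 2 := by
  have hU' : Uᴴ * U = 1 := Matrix.mem_unitaryGroup_iff'.1 hU
  have hV' : Vᴴ * V = 1 := Matrix.mem_unitaryGroup_iff'.1 hV
  have e : Aᴴ * B = V * ((rectDiag 𝕜 m n (sigma A))ᴴ * (Uᴴ * U) * rectDiag 𝕜 m n (sigma B)) * Vᴴ := by
    conv_lhs => rw [hA, hB]
    simp only [Matrix.conjTranspose_mul, Matrix.conjTranspose_conjTranspose, Matrix.mul_assoc]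
  rw [sum_norm_sub_sq, e, Matrix.trace_mul_comm, ← Matrix.mul_assoc, hV', Matrix.one_mul, hU',
    Matrix.mul_one, conjTranspose_rectDiag_mul, Matrix.trace_diagonal, map_sum, add_eq_left,
    mul_eq_zero, sub_eq_zero]
  refine Or.inr (Finset.sum_congr rfl fun j _ => ?_)
  split_ifs with h
  · rw [RCLike.ofReal_re]
  · rw [sigma_of_ge A (not_lt.1 h)]
    simp

end MatrixSVD

/-! ### The discrete Fourier transform along the third mode -/

section Fourier

variable {n : ℕ} [NeZero n]

/-- The kernel `exp (-2πi k t / n)` of the discrete Fourier transform. -/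
noncomputable def dftKernel (k t : Fin n) : ℂ :=
  ZMod.stdAddChar (-(ZMod.finEquiv n k * ZMod.finEquiv n t))

lemma finEquiv_apply (k : Fin n) : ZMod.finEquiv n k = (k.val : ZMod n) := by
  obtain ⟨m, rfl⟩ := Nat.exists_eq_succ_of_ne_zero (NeZero.ne n)
  exact (ZMod.natCast_zmod_val (n := m + 1) k).symm

lemma dftKernel_eq_exp (k t : Fin n) :
    dftKernel k t =
      Complex.exp (-(2 * Real.pi * Complex.I * (k.val : ℂ) * (t.val : ℂ) / (n : ℂ))) := by
  have h := ZMod.stdAddChar_coe (N := n) (-((k.val : ℤ) * (t.val : ℤ)))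
  rw [dftKernel, finEquiv_apply, finEquiv_apply]
  push_cast at h
  rw [h]
  congr 1
  ring

lemma dftKernel_comm (k t : Fin n) : dftKernel k t = dftKernel t k := by
  rw [dftKernel, dftKernel, mul_comm]

lemma dftKernel_add (k s t : Fin n) : dftKernel k (s + t) = dftKernel k s * dftKernel k t := by
  rw [dftKernel, dftKernel, dftKernel, map_add, mul_add, neg_add, AddChar.map_add_eq_mul]

lemma dftKernel_neg (k t : Fin n) : dftKernel k (-t) = (starRingEnd ℂ) (dftKernel k t) := by
  rw [dftKernel, dftKernel, map_neg (ZMod.finEquiv n), mul_neg, AddChar.map_neg_eq_conj]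

lemma dftKernel_neg_left (k t : Fin n) : dftKernel (-k) t = (starRingEnd ℂ) (dftKernel k t) := by
  rw [dftKernel_comm, dftKernel_neg, dftKernel_comm]

lemma dftKernel_zero (k : Fin n) : dftKernel k 0 = 1 := by
  rw [dftKernel, map_zero, mul_zero, neg_zero, AddChar.map_zero_eq_one]

lemma dftKernel_sub (k s t : Fin n) :
    dftKernel k (s - t) = dftKernel k s * (starRingEnd ℂ) (dftKernel k t) := by
  rw [sub_eq_add_neg, dftKernel_add, dftKernel_neg]

/-- Orthogonality of characters, from primitivity of the standard additive character of `ZMod n`. -/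
lemma sum_dftKernel (t : Fin n) : ∑ k, dftKernel k t = if t = 0 then (n : ℂ) else 0 := by
  have h := AddChar.sum_mulShift (-(ZMod.finEquiv n t)) (ZMod.isPrimitive_stdAddChar n)
  rw [← Equiv.sum_comp (ZMod.finEquiv n).toEquiv] at h
  simp only [mul_neg, neg_eq_zero, ZMod.card] at h
  refine h.trans ?_
  by_cases ht : t = 0 <;> simp [ht]

/-- The discrete Fourier transform of a real sequence. -/
noncomputable def seqDft (x : Fin n → ℝ) (k : Fin n) : ℂ := ∑ t, dftKernel k t * (x t : ℂ)

lemma seqDft_neg (x : Fin n → ℝ) (k : Fin n) :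
    seqDft x (-k) = (starRingEnd ℂ) (seqDft x k) := by
  simp [seqDft, map_sum, dftKernel_neg_left]

/-- Parseval's identity; orthogonality of characters collapses the double sum to its diagonal. -/
lemma sum_norm_seqDft_sq (x : Fin n → ℝ) : ∑ k, ‖seqDft x k‖ ^ 2 = n * ∑ t, x t ^ 2 := by
  have h : ∑ k, seqDft x k * (starRingEnd ℂ) (seqDft x k) = n * ∑ t, (x t : ℂ) ^ 2 := by
    calc ∑ k, seqDft x k * (starRingEnd ℂ) (seqDft x k)
        = ∑ k, ∑ t, ∑ s, (x t : ℂ) * x s * dftKernel k (t - s) := by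
          refine Finset.sum_congr rfl fun k _ => ?_
          rw [seqDft, map_sum, Finset.sum_mul_sum]
          refine Finset.sum_congr rfl fun t _ => Finset.sum_congr rfl fun s _ => ?_
          rw [dftKernel_sub, map_mul, Complex.conj_ofReal]
          ring
      _ = ∑ t, ∑ s, (x t : ℂ) * x s * ∑ k, dftKernel k (t - s) := by
          rw [Finset.sum_comm]
          refine Finset.sum_congr rfl fun t _ => ?_
          rw [Finset.sum_comm]
          simp_rw [Finset.mul_sum]
      _ = ∑ t, (x t : ℂ) * x t * n := by
          refine Finset.sum_congr rfl fun t _ => ?_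
          rw [Finset.sum_eq_single t]
          · simp [sum_dftKernel]
          · intro s _ hs
            rw [sum_dftKernel, if_neg (sub_ne_zero.2 hs.symm), mul_zero]
          · simp
      _ = _ := by
          rw [Finset.mul_sum]
          exact Finset.sum_congr rfl fun t _ => by ring
  have h2 : ((∑ k, ‖seqDft x k‖ ^ 2 : ℝ) : ℂ) = ((n * ∑ t, x t ^ 2 : ℝ) : ℂ) := by
    push_cast
    rw [← h]
    exact Finset.sum_congr rfl fun k _ => (Complex.mul_conj' _).symm
  exact Complex.ofReal_injective h2

lemma eq_zero_of_seqDft_eq_zero {x : Fin n → ℝ} (h : ∀ k, seqDft x k = 0) (t : Fin n) :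
    x t = 0 := by
  have h1 := sum_norm_seqDft_sq x
  simp only [h, norm_zero, ne_eq, OfNat.ofNat_ne_zero, not_false_eq_true, zero_pow,
    Finset.sum_const_zero, zero_eq_mul, Nat.cast_eq_zero, NeZero.ne n, false_or] at h1
  rw [Finset.sum_eq_zero_iff_of_nonneg fun _ _ => sq_nonneg _] at h1
  simpa using h1 t (Finset.mem_univ t)

/-- Every conjugate symmetric sequence is the discrete Fourier transform of a real sequence. -/
lemma exists_seqDft_eq {z : Fin n → ℂ} (hz : ∀ k, z (-k) = (starRingEnd ℂ) (z k)) :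
    ∃ x : Fin n → ℝ, ∀ k, seqDft x k = z k := by
  have hn : (n : ℂ) ≠ 0 := Nat.cast_ne_zero.2 (NeZero.ne n)
  -- The inverse transform; it is real because conjugation only reindexes the sum by `k ↦ -k`.
  let y : Fin n → ℂ := fun t => (n : ℂ)⁻¹ * ∑ k, (starRingEnd ℂ) (dftKernel k t) * z k
  have hreal : ∀ t, ((y t).re : ℂ) = y t := by
    intro t
    rw [← Complex.conj_eq_iff_re]
    simp only [y, map_mul, map_inv₀, Complex.conj_natCast, map_sum, Complex.conj_conj, ← hz]
    congr 1
    rw [← Equiv.sum_comp (Equiv.neg (Fin n))]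
    simp [dftKernel_neg_left]
  refine ⟨fun t => (y t).re, fun k => ?_⟩
  rw [seqDft]
  simp_rw [hreal]
  calc ∑ t, dftKernel k t * y t
      = ∑ t, ∑ l, (n : ℂ)⁻¹ * z l * dftKernel t (k - l) := by
        refine Finset.sum_congr rfl fun t _ => ?_
        simp only [y, Finset.mul_sum]
        refine Finset.sum_congr rfl fun l _ => ?_
        rw [dftKernel_sub, dftKernel_comm t k, dftKernel_comm t l]
        ring
    _ = ∑ l, (n : ℂ)⁻¹ * z l * ∑ t, dftKernel t (k - l) := by
        rw [Finset.sum_comm]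
        simp_rw [Finset.mul_sum]
    _ = z k := by
        rw [Finset.sum_eq_single k]
        · rw [sum_dftKernel, sub_self, if_pos rfl]
          field_simp
        · intro l _ hl
          rw [sum_dftKernel, if_neg (sub_ne_zero.2 hl.symm), mul_zero]
        · simp

variable {n₁ n₂ : ℕ}

lemma dft_apply (X : Tensor3 ℝ n₁ n₂ n) (k : Fin n) (a : Fin n₁) (b : Fin n₂) :
    dft X k a b = seqDft (fun t => X t a b) k := by
  simp only [dft, seqDft, Matrix.of_apply, dftKernel_eq_exp]

lemma dft_injective {X Y : Tensor3 ℝ n₁ n₂ n} (h : ∀ k, dft X k = dft Y k) : X = Y := by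
  ext t a b
  rw [← sub_eq_zero]
  refine eq_zero_of_seqDft_eq_zero (x := fun t => X t a b - Y t a b) (fun k => ?_) t
  have h1 := congrFun (congrFun (h k) a) b
  rw [dft_apply, dft_apply, ← sub_eq_zero] at h1
  rw [← h1, seqDft, seqDft, seqDft, ← Finset.sum_sub_distrib]
  exact Finset.sum_congr rfl fun t _ => by push_cast; ring

lemma dft_neg (X : Tensor3 ℝ n₁ n₂ n) (k : Fin n) :
    dft X (-k) = (dft X k).map (starRingEnd ℂ) := by
  ext a b
  rw [Matrix.map_apply, dft_apply, dft_apply, seqDft_neg]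

lemma exists_dft_eq {Z : Tensor3 ℂ n₁ n₂ n} (hZ : ∀ k, Z (-k) = (Z k).map (starRingEnd ℂ)) :
    ∃ X : Tensor3 ℝ n₁ n₂ n, ∀ k, dft X k = Z k := by
  have h : ∀ a b, ∃ x : Fin n → ℝ, ∀ k, seqDft x k = Z k a b := fun a b =>
    exists_seqDft_eq (z := fun k => Z k a b) fun k => by rw [hZ, Matrix.map_apply]
  choose x hx using h
  refine ⟨fun t => Matrix.of fun a b => x a b t, fun k => ?_⟩
  ext a b
  rw [dft_apply]
  exact hx a b k

lemma dft_tconj (A : Tensor3 ℝ n₁ n₂ n) (k : Fin n) : dft (tconj A) k = (dft A k)ᴴ := by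
  ext a b
  rw [Matrix.conjTranspose_apply, dft_apply, dft_apply, seqDft, seqDft,
    ← Equiv.sum_comp (Equiv.neg (Fin n))]
  simp [tconj, dftKernel_neg]

lemma dft_tid (m : ℕ) (k : Fin n) : dft (tid m n) k = 1 := by
  ext a b
  rw [dft_apply, seqDft, Finset.sum_eq_single 0]
  · by_cases h : a = b <;> simp [tid, dftKernel_zero, Matrix.one_apply, h]
  · intro t _ ht
    have : t.val ≠ 0 := fun h => ht (Fin.ext h)
    simp [tid, this]
  · simp

lemma seqDft_mul_seqDft (x y : Fin n → ℝ) (k : Fin n) :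
    seqDft (fun t => ∑ q, x (t - q) * y q) k = seqDft x k * seqDft y k := by
  rw [seqDft, seqDft, seqDft, Finset.sum_mul_sum, Finset.sum_comm]
  simp only [Complex.ofReal_sum, Complex.ofReal_mul, Finset.mul_sum]
  rw [Finset.sum_comm]
  refine Finset.sum_congr rfl fun q _ => ?_
  rw [← Equiv.sum_comp (Equiv.addRight q)]
  refine Finset.sum_congr rfl fun s _ => ?_
  rw [Equiv.coe_addRight, add_sub_cancel_right, dftKernel_add]
  ring

lemma seqDft_sum {ι : Type*} (s : Finset ι) (x : ι → Fin n → ℝ) (k : Fin n) :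
    seqDft (fun t => ∑ l ∈ s, x l t) k = ∑ l ∈ s, seqDft (x l) k := by
  simp only [seqDft, Complex.ofReal_sum, Finset.mul_sum]
  exact Finset.sum_comm

/-- The block circulant product is a circular convolution of slices, which the transform turns into
slicewise matrix products. -/
lemma dft_tMul {m : ℕ} (A : Tensor3 ℝ n₁ n₂ n) (B : Tensor3 ℝ n₂ m n) (k : Fin n) :
    dft (tMul A B) k = dft A k * dft B k := by
  ext a b
  have h1 : (fun t => tMul A B t a b) =
      fun t => ∑ l, ∑ q, (fun s => A s a l) (t - q) * (fun s => B s l b) q := by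
    funext t
    rw [Finset.sum_comm, tMul, bvfold, Matrix.of_apply, Matrix.mul_apply, Fintype.sum_prod_type]
    rfl
  rw [dft_apply, h1, seqDft_sum, Matrix.mul_apply]
  refine Finset.sum_congr rfl fun l _ => ?_
  refine (seqDft_mul_seqDft (fun s => A s a l) (fun s => B s l b) k).trans ?_
  rw [dft_apply, dft_apply]

lemma sum_rotate {α β γ : Type*} [Fintype α] [Fintype β] [Fintype γ] (F : α → β → γ → ℝ) :
    ∑ k, ∑ a, ∑ b, F k a b = ∑ a, ∑ b, ∑ k, F k a b := by
  rw [Finset.sum_comm]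
  exact Finset.sum_congr rfl fun a _ => Finset.sum_comm

lemma sum_norm_dft_sub_sq (X Y : Tensor3 ℝ n₁ n₂ n) :
    ∑ k, ∑ a, ∑ b, ‖dft X k a b - dft Y k a b‖ ^ 2 = n * frobNorm (X - Y) ^ 2 := by
  have h : ∀ a b, ∑ k, ‖dft X k a b - dft Y k a b‖ ^ 2 = n * ∑ t, (X t a b - Y t a b) ^ 2 := by
    intro a b
    rw [← sum_norm_seqDft_sq]
    refine Finset.sum_congr rfl fun k _ => ?_
    rw [dft_apply, dft_apply, seqDft, seqDft, seqDft, ← Finset.sum_sub_distrib]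
    congr 2
    exact Finset.sum_congr rfl fun t _ => by push_cast; ring
  have hF : frobNorm (X - Y) ^ 2 = ∑ k, ∑ a, ∑ b, (X k a b - Y k a b) ^ 2 :=
    Real.sq_sqrt (Finset.sum_nonneg fun _ _ => Finset.sum_nonneg fun _ _ =>
      Finset.sum_nonneg fun _ _ => sq_nonneg _)
  rw [hF, sum_rotate, sum_rotate fun k a b => (X k a b - Y k a b) ^ 2, Finset.mul_sum]
  refine Finset.sum_congr rfl fun a _ => ?_
  rw [Finset.mul_sum]
  exact Finset.sum_congr rfl fun b _ => h a b

end Fourier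

/-! ### Slicewise description of t-SVDs -/

section TSVD

/-- Star-preserving ring homomorphisms map singular value decompositions to singular value
decompositions. -/
lemma map_svd {𝕜 𝕜' : Type*} [RCLike 𝕜] [RCLike 𝕜'] {m n : ℕ} (f : 𝕜 →+* 𝕜')
    (hf : ∀ x, f (star x) = star (f x)) (hr : ∀ r : ℝ, f (r : 𝕜) = (r : 𝕜'))
    {A : Matrix (Fin m) (Fin n) 𝕜} {U : Matrix (Fin m) (Fin m) 𝕜} {V : Matrix (Fin n) (Fin n) 𝕜}
    {s : ℕ → ℝ} (hA : A = U * rectDiag 𝕜 m n s * Vᴴ) :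
    A.map f = U.map f * rectDiag 𝕜' m n s * (V.map f)ᴴ := by
  have h1 : (rectDiag 𝕜 m n s).map f = rectDiag 𝕜' m n s := by
    ext a b
    simp only [rectDiag, Matrix.map_apply, Matrix.of_apply]
    split_ifs
    · exact hr _
    · exact map_zero f
  rw [hA, Matrix.map_mul, Matrix.map_mul, h1, Matrix.conjTranspose_map f (fun x => hf x)]

lemma map_mem_unitaryGroup {𝕜 𝕜' : Type*} [RCLike 𝕜] [RCLike 𝕜'] {n : ℕ} (f : 𝕜 →+* 𝕜')
    (hf : ∀ x, f (star x) = star (f x)) {U : Matrix (Fin n) (Fin n) 𝕜}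
    (hU : U ∈ Matrix.unitaryGroup (Fin n) 𝕜) : U.map f ∈ Matrix.unitaryGroup (Fin n) 𝕜' := by
  rw [Matrix.mem_unitaryGroup_iff, Matrix.star_eq_conjTranspose] at hU ⊢
  rw [← Matrix.conjTranspose_map f (fun x => hf x), ← Matrix.map_mul, hU,
    Matrix.map_one f (map_zero f) (map_one f)]

/-- A decomposition of `A` is carried to one of `A.map f` with the same diagonal. It is used for
complex conjugation and for the inclusion of `ℝ` in `ℂ`. -/
lemma sigma_map {𝕜 𝕜' : Type*} [RCLike 𝕜] [RCLike 𝕜'] {m n : ℕ} (f : 𝕜 →+* 𝕜')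
    (hf : ∀ x, f (star x) = star (f x)) (hr : ∀ r : ℝ, f (r : 𝕜) = (r : 𝕜'))
    (A : Matrix (Fin m) (Fin n) 𝕜) (j : ℕ) (hj : j < min m n) :
    sigma (A.map f) j = sigma A j := by
  obtain ⟨U, hU, V, hV, h⟩ := exists_matrix_svd A
  exact sigma_of_svd (map_mem_unitaryGroup f hf hU) (map_mem_unitaryGroup f hf hV)
    (fun j _ => sigma_nonneg A j) (fun i j hij _ => sigma_antitone A hij) (map_svd f hf hr h) j hj

lemma conj_star (x : ℂ) : (starRingEnd ℂ) (star x) = star ((starRingEnd ℂ) x) := rfl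

lemma ofReal_star (x : ℝ) : Complex.ofRealHom (star x) = star (Complex.ofRealHom x) :=
  (Complex.conj_ofReal x).symm

lemma rectDiag_map_conj {m n : ℕ} (s : ℕ → ℝ) :
    (rectDiag ℂ m n s).map (starRingEnd ℂ) = rectDiag ℂ m n s := by
  ext a b
  simp only [rectDiag, Matrix.map_apply, Matrix.of_apply]
  split_ifs
  · exact Complex.conj_ofReal _
  · exact map_zero _

lemma map_conj_map_conj {m n : ℕ} (A : Matrix (Fin m) (Fin n) ℂ) :
    (A.map (starRingEnd ℂ)).map (starRingEnd ℂ) = A := by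
  ext a b
  simp

lemma map_ofReal_map_conj {m n : ℕ} (A : Matrix (Fin m) (Fin n) ℝ) :
    (A.map Complex.ofRealHom).map (starRingEnd ℂ) = A.map Complex.ofRealHom := by
  ext a b
  simp

/-- Choice of a family over `Fin n` that is equivariant under negation. -/
lemma exists_equivariant_choice {n : ℕ} [NeZero n] {α : Type*} {c : α → α}
    (hc : ∀ z, c (c z) = z) {Q : Fin n → α → Prop} (hQ : ∀ i z, Q i z → Q (-i) (c z))
    (h : ∀ i, ∃ z, Q i z) (hfix : ∀ i, -i = i → ∃ z, Q i z ∧ c z = z) :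
    ∃ Z : Fin n → α, ∀ i, Q i (Z i) ∧ Z (-i) = c (Z i) := by
  choose f hf using h
  choose g hg using hfix
  -- One free choice is made at the smaller index of each pair `{i, -i}` and transported by `c`;
  -- self-paired indices take a `c`-fixed choice.
  let Z : Fin n → α := fun i => if h : -i = i then g i h else if i < -i then f i else c (f (-i))
  refine ⟨Z, fun i => ?_⟩
  by_cases hi : -i = i
  · have hZ : Z i = g i hi := by simp only [Z, dif_pos hi]
    refine ⟨hZ ▸ (hg i hi).1, ?_⟩
    rw [hi, hZ, (hg i hi).2]
  · have hi' : ¬ - -i = -i := by rw [neg_neg]; exact fun h => hi h.symm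
    rcases lt_or_gt_of_ne (Ne.symm hi) with hlt | hlt
    · have hZ : Z i = f i := by simp only [Z, dif_neg hi, if_pos hlt]
      have hZ' : Z (-i) = c (f i) := by
        simp only [Z, dif_neg hi', neg_neg, if_neg hlt.not_gt]
      exact ⟨hZ ▸ hf i, by rw [hZ', hZ]⟩
    · have hZ : Z i = c (f (-i)) := by simp only [Z, dif_neg hi, if_neg hlt.not_gt]
      have hZ' : Z (-i) = f (-i) := by
        simp only [Z, dif_neg hi', neg_neg, if_pos hlt]
      refine ⟨?_, by rw [hZ', hZ, hc]⟩
      have := hQ (-i) (f (-i)) (hf (-i))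
      rwa [neg_neg, ← hZ] at this

variable {n₁ n₂ n₃ : ℕ} [NeZero n₃]

lemma sv_neg (X : Tensor3 ℝ n₁ n₂ n₃) (i : Fin n₃) (j : Fin (min n₁ n₂)) :
    sv X (-i) j = sv X i j := by
  change sigma (dft X (-i)) j = sigma (dft X i) j
  rw [dft_neg]
  exact sigma_map _ conj_star (fun r => Complex.conj_ofReal r) _ j j.2

lemma isOrthogonal_iff {m : ℕ} (Q : Tensor3 ℝ m m n₃) :
    IsOrthogonal Q ↔ ∀ i, dft Q i ∈ Matrix.unitaryGroup (Fin m) ℂ := by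
  constructor
  · rintro ⟨h, -⟩ i
    rw [Matrix.mem_unitaryGroup_iff, Matrix.star_eq_conjTranspose, ← dft_tconj, ← dft_tMul, h,
      dft_tid]
  · intro h
    constructor <;> refine dft_injective fun i => ?_
    · rw [dft_tMul, dft_tconj, dft_tid]
      exact Matrix.mem_unitaryGroup_iff.1 (h i)
    · rw [dft_tMul, dft_tconj, dft_tid]
      exact Matrix.mem_unitaryGroup_iff'.1 (h i)

lemma dft_eq_rectDiag_iff {S : Tensor3 ℝ n₁ n₂ n₃} {s : Fin n₃ → ℕ → ℝ} :
    (∀ i, dft S i = rectDiag ℂ n₁ n₂ (s i)) ↔ IsFDiagonal S ∧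
      ∀ (i : Fin n₃) (j : Fin (min n₁ n₂)),
        dft S i (Fin.castLE (min_le_left n₁ n₂) j) (Fin.castLE (min_le_right n₁ n₂) j) =
          (s i j : ℂ) := by
  constructor
  · intro h
    refine ⟨fun k a b hab => ?_, fun i j => by rw [h]; simp [rectDiag]⟩
    refine eq_zero_of_seqDft_eq_zero (x := fun t => S t a b) (fun i => ?_) k
    rw [← dft_apply, h]
    simp [rectDiag, hab]
  · rintro ⟨h1, h2⟩ i
    ext a b
    simp only [rectDiag, Matrix.of_apply]
    split_ifs with hab
    · have := h2 i ⟨a, lt_min a.2 (hab ▸ b.2)⟩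
      have eb : b = Fin.castLE (min_le_right n₁ n₂) ⟨a, lt_min a.2 (hab ▸ b.2)⟩ := Fin.ext hab.symm
      rw [eb]
      exact this
    · rw [dft_apply, seqDft]
      exact Finset.sum_eq_zero fun t _ => by rw [h1 t a b hab]; simp

/-- The transform is injective and turns t-products and tensor transposes into their matrix
counterparts, so a t-SVD is a family of matrix decompositions coming from real tensors. -/
lemma isTSVD_iff {X : Tensor3 ℝ n₁ n₂ n₃} {U : Tensor3 ℝ n₁ n₁ n₃} {S : Tensor3 ℝ n₁ n₂ n₃}
    {V : Tensor3 ℝ n₂ n₂ n₃} :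
    IsTSVD X U S V ↔ (∀ i, dft U i ∈ Matrix.unitaryGroup (Fin n₁) ℂ) ∧
      (∀ i, dft V i ∈ Matrix.unitaryGroup (Fin n₂) ℂ) ∧
      (∀ i, dft S i = rectDiag ℂ n₁ n₂ (sigma (dft X i))) ∧
      ∀ i, dft X i = dft U i * dft S i * (dft V i)ᴴ := by
  have hfac : X = tMul (tMul U S) (tconj V) ↔ ∀ i, dft X i = dft U i * dft S i * (dft V i)ᴴ := by
    constructor
    · intro h i
      conv_lhs => rw [h]
      rw [dft_tMul, dft_tMul, dft_tconj]
    · intro h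
      refine dft_injective fun i => ?_
      rw [h, dft_tMul, dft_tMul, dft_tconj]
  rw [dft_eq_rectDiag_iff, ← isOrthogonal_iff, ← isOrthogonal_iff, ← hfac]
  exact ⟨fun h => ⟨h.1, h.2, ⟨h.3, h.4⟩, h.5⟩, fun h => ⟨h.1, h.2.1, h.2.2.1.1, h.2.2.1.2, h.2.2.2⟩⟩

/-- A real tensor whose Fourier slices are prescribed rectangular diagonal matrices. -/
lemma exists_dft_eq_rectDiag {s : Fin n₃ → ℕ → ℝ} (hs : ∀ i, ∀ j < min n₁ n₂, s (-i) j = s i j) :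
    ∃ S : Tensor3 ℝ n₁ n₂ n₃, ∀ i, dft S i = rectDiag ℂ n₁ n₂ (s i) :=
  exists_dft_eq (Z := fun i => rectDiag ℂ n₁ n₂ (s i)) fun i => by
    rw [rectDiag_map_conj]
    exact rectDiag_congr (hs i)

lemma exists_map_ofReal_eq {m n : ℕ} {A : Matrix (Fin m) (Fin n) ℂ}
    (hA : A.map (starRingEnd ℂ) = A) :
    ∃ B : Matrix (Fin m) (Fin n) ℝ, A = B.map Complex.ofRealHom := by
  refine ⟨A.map Complex.re, ?_⟩
  ext a b
  have := congrFun (congrFun hA a) b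
  rw [Matrix.map_apply, Complex.conj_eq_iff_re] at this
  simp [this]

/-- Two real tensors whose Fourier slices attain equality in Mirsky's inequality have t-SVDs with
the same orthogonal factors. -/
theorem exists_common_tsvd {X Y : Tensor3 ℝ n₁ n₂ n₃}
    (h : ∀ i, ∑ a, ∑ b, ‖dft X i a b - dft Y i a b‖ ^ 2 =
      ∑ j : Fin (min n₁ n₂), (sigma (dft X i) j - sigma (dft Y i) j) ^ 2) :
    ∃ U S₁ S₂ V, IsTSVD Y U S₂ V ∧ IsTSVD X U S₁ V := by
  let Q : Fin n₃ → Matrix (Fin n₁) (Fin n₁) ℂ × Matrix (Fin n₂) (Fin n₂) ℂ → Prop := fun i z =>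
    z.1 ∈ Matrix.unitaryGroup (Fin n₁) ℂ ∧ z.2 ∈ Matrix.unitaryGroup (Fin n₂) ℂ ∧
    dft X i = z.1 * rectDiag ℂ n₁ n₂ (sigma (dft X i)) * z.2ᴴ ∧
    dft Y i = z.1 * rectDiag ℂ n₁ n₂ (sigma (dft Y i)) * z.2ᴴ
  let c : Matrix (Fin n₁) (Fin n₁) ℂ × Matrix (Fin n₂) (Fin n₂) ℂ →
      Matrix (Fin n₁) (Fin n₁) ℂ × Matrix (Fin n₂) (Fin n₂) ℂ :=
    fun z => (z.1.map (starRingEnd ℂ), z.2.map (starRingEnd ℂ))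
  have hsig : ∀ (W : Tensor3 ℝ n₁ n₂ n₃) (i : Fin n₃),
      rectDiag ℂ n₁ n₂ (sigma (dft W (-i))) = rectDiag ℂ n₁ n₂ (sigma (dft W i)) :=
    fun W i => rectDiag_congr fun j hj => sv_neg W i ⟨j, hj⟩
  obtain ⟨Z, hZ⟩ := exists_equivariant_choice (c := c) (Q := Q)
    (fun z => Prod.ext (map_conj_map_conj _) (map_conj_map_conj _))
    (fun i z hz => by
      refine ⟨map_mem_unitaryGroup _ conj_star hz.1, map_mem_unitaryGroup _ conj_star hz.2.1, ?_, ?_⟩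
      · rw [hsig, dft_neg]
        exact map_svd _ conj_star (fun r => Complex.conj_ofReal r) hz.2.2.1
      · rw [hsig, dft_neg]
        exact map_svd _ conj_star (fun r => Complex.conj_ofReal r) hz.2.2.2)
    (fun i => by
      obtain ⟨U, hU, V, hV, h1, h2⟩ := exists_common_matrix_svd_of_sum_sq_eq (h i)
      exact ⟨(U, V), hU, hV, h1, h2⟩)
    -- For `-i = i` the slices are real. Their real forms also attain equality in Mirsky's
    -- inequality, and a common real decomposition is invariant under conjugation.
    (fun i hi => by
      obtain ⟨A, hA⟩ := exists_map_ofReal_eq (A := dft X i) (by rw [← dft_neg, hi])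
      obtain ⟨B, hB⟩ := exists_map_ofReal_eq (A := dft Y i) (by rw [← dft_neg, hi])
      have hsA : ∀ j < min n₁ n₂, sigma (dft X i) j = sigma A j := fun j hj => by
        rw [hA]; exact sigma_map _ ofReal_star (fun r => rfl) A j hj
      have hsB : ∀ j < min n₁ n₂, sigma (dft Y i) j = sigma B j := fun j hj => by
        rw [hB]; exact sigma_map _ ofReal_star (fun r => rfl) B j hj
      have hAB : ∑ a, ∑ b, ‖A a b - B a b‖ ^ 2 =
          ∑ j : Fin (min n₁ n₂), (sigma A j - sigma B j) ^ 2 := by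
        have e1 : ∑ j : Fin (min n₁ n₂), (sigma A j - sigma B j) ^ 2 =
            ∑ j : Fin (min n₁ n₂), (sigma (dft X i) j - sigma (dft Y i) j) ^ 2 :=
          Finset.sum_congr rfl fun j _ => by rw [hsA j j.2, hsB j j.2]
        rw [e1, ← h i, hA, hB]
        refine Finset.sum_congr rfl fun a _ => Finset.sum_congr rfl fun b _ => ?_
        rw [Matrix.map_apply, Matrix.map_apply, ← map_sub, Complex.ofRealHom_eq_coe,
          Complex.norm_real]
      obtain ⟨U, hU, V, hV, h1, h2⟩ := exists_common_matrix_svd_of_sum_sq_eq hAB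
      refine ⟨(U.map Complex.ofRealHom, V.map Complex.ofRealHom),
        ⟨map_mem_unitaryGroup _ ofReal_star hU, map_mem_unitaryGroup _ ofReal_star hV, ?_, ?_⟩,
        Prod.ext (map_ofReal_map_conj U) (map_ofReal_map_conj V)⟩
      · rw [rectDiag_congr hsA, hA]
        exact map_svd _ ofReal_star (fun r => rfl) h1
      · rw [rectDiag_congr hsB, hB]
        exact map_svd _ ofReal_star (fun r => rfl) h2)
  obtain ⟨U, hU⟩ := exists_dft_eq (Z := fun i => (Z i).1) fun i => by rw [(hZ i).2]
  obtain ⟨V, hV⟩ := exists_dft_eq (Z := fun i => (Z i).2) fun i => by rw [(hZ i).2]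
  obtain ⟨S₁, hS₁⟩ := exists_dft_eq_rectDiag (n₁ := n₁) (n₂ := n₂)
    (s := fun i => sigma (dft X i)) fun i j hj => sv_neg X i ⟨j, hj⟩
  obtain ⟨S₂, hS₂⟩ := exists_dft_eq_rectDiag (n₁ := n₁) (n₂ := n₂)
    (s := fun i => sigma (dft Y i)) fun i j hj => sv_neg Y i ⟨j, hj⟩
  refine ⟨U, S₁, S₂, V, isTSVD_iff.2 ⟨fun i => ?_, fun i => ?_, hS₂, fun i => ?_⟩,
    isTSVD_iff.2 ⟨fun i => ?_, fun i => ?_, hS₁, fun i => ?_⟩⟩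
  · rw [hU]; exact (hZ i).1.1
  · rw [hV]; exact (hZ i).1.2.1
  · rw [hU, hV, hS₂]; exact (hZ i).1.2.2.2
  · rw [hU]; exact (hZ i).1.1
  · rw [hV]; exact (hZ i).1.2.1
  · rw [hU, hV, hS₁]; exact (hZ i).1.2.2.1

theorem exists_tsvd (Y : Tensor3 ℝ n₁ n₂ n₃) : ∃ U S V, IsTSVD Y U S V := by
  obtain ⟨U, _, S, V, h, -⟩ := exists_common_tsvd (X := Y) (Y := Y) fun i => by simp
  exact ⟨U, S, V, h⟩

/-- t-SVDs with the same orthogonal factors give equality in Mirsky's inequality slice by slice. -/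
lemma sum_norm_sub_sq_of_isTSVD {X Y : Tensor3 ℝ n₁ n₂ n₃} {U : Tensor3 ℝ n₁ n₁ n₃}
    {S₁ S₂ : Tensor3 ℝ n₁ n₂ n₃} {V : Tensor3 ℝ n₂ n₂ n₃} (hX : IsTSVD X U S₁ V)
    (hY : IsTSVD Y U S₂ V) (i : Fin n₃) :
    ∑ a, ∑ b, ‖dft X i a b - dft Y i a b‖ ^ 2 =
      ∑ j : Fin (min n₁ n₂), (sigma (dft X i) j - sigma (dft Y i) j) ^ 2 := by
  obtain ⟨hU, hV, h1, h2⟩ := isTSVD_iff.1 hX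
  obtain ⟨-, -, h3, h4⟩ := isTSVD_iff.1 hY
  refine sum_norm_sub_sq_of_common_svd (hU i) (hV i) ?_ ?_
  · rw [← h1]; exact h2 i
  · rw [← h3]; exact h4 i

end TSVD

/-! ### The tensor proximal problem -/

section Prox

variable {n₁ n₂ n₃ : ℕ} {ρ ν ϑ c : ℝ} {w : Fin (min n₁ n₂) → Fin n₃ → ℝ}

lemma sv_nonneg (X : Tensor3 ℝ n₁ n₂ n₃) (i : Fin n₃) (j : Fin (min n₁ n₂)) : 0 ≤ sv X i j :=
  sigma_nonneg _ _

lemma sv_antitone (X : Tensor3 ℝ n₁ n₂ n₃) (i : Fin n₃) : Antitone (sv X i) :=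
  fun _ _ h => sigma_antitone (dft X i) h

lemma weight_pos (hc : 0 ≤ c) (j : Fin (min n₁ n₂)) (i : Fin n₃) : 0 < weight c w j i := by
  have := Real.exp_pos (-(w (Fin.rev j) i))
  unfold weight
  positivity

/-- The sum of the scalar objectives at the singular values. -/
noncomputable def spectralObjective (ρ ν ϑ c : ℝ) (w : Fin (min n₁ n₂) → Fin n₃ → ℝ)
    (Y L : Tensor3 ℝ n₁ n₂ n₃) : ℝ :=
  ∑ i, ∑ j, scalarObjective ρ ν ϑ (weight c w j i) (sv Y i j) (sv L i j)

/-- The deficit in Mirsky's inequality for the `i`-th Fourier slices. -/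
noncomputable def mirskyGap (Y L : Tensor3 ℝ n₁ n₂ n₃) (i : Fin n₃) : ℝ :=
  ∑ a, ∑ b, ‖dft L i a b - dft Y i a b‖ ^ 2 - ∑ j, (sv L i j - sv Y i j) ^ 2

lemma mirskyGap_nonneg (Y L : Tensor3 ℝ n₁ n₂ n₃) (i : Fin n₃) : 0 ≤ mirskyGap Y L i :=
  sub_nonneg.2 (sum_sq_sigma_sub_le (dft L i) (dft Y i))

lemma spectralObjective_le_of_mem {Y L : Tensor3 ℝ n₁ n₂ n₃}
    (h : ∀ i j, sv L i j ∈ scalarProxSet ρ ν ϑ (weight c w j i) (sv Y i j))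
    (L' : Tensor3 ℝ n₁ n₂ n₃) :
    spectralObjective ρ ν ϑ c w Y L ≤ spectralObjective ρ ν ϑ c w Y L' :=
  Finset.sum_le_sum fun i _ => Finset.sum_le_sum fun j _ => (h i j).2 _ (sv_nonneg L' i j)

variable [NeZero n₃]

/-- The decoupling identity: adding and subtracting the squared singular value differences in
Parseval's formula separates a spectral term from a nonnegative term measuring misaligned singular
vectors. -/
lemma proxObjective_eq (ρ ν ϑ c : ℝ) (w : Fin (min n₁ n₂) → Fin n₃ → ℝ)
    (Y L : Tensor3 ℝ n₁ n₂ n₃) :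
    (n₃ : ℝ) * proxObjective ρ ν ϑ c w Y L =
      spectralObjective ρ ν ϑ c w Y L + ρ / 2 * ∑ i, mirskyGap Y L i := by
  have hn : (n₃ : ℝ) ≠ 0 := Nat.cast_ne_zero.2 (NeZero.ne n₃)
  have h1 := sum_norm_dft_sub_sq L Y
  have h2 : (n₃ : ℝ) * proxObjective ρ ν ϑ c w Y L = ρ / 2 * (n₃ * frobNorm (L - Y) ^ 2) +
      ∑ i : Fin n₃, ∑ j : Fin (min n₁ n₂),
        weight c w j i * Real.log (mcp ν ϑ (sv L i j) + 1) := by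
    rw [proxObjective, lcNorm]
    field_simp
  rw [h2, ← h1, spectralObjective]
  simp only [scalarObjective, mirskyGap, Finset.sum_add_distrib, Finset.sum_sub_distrib,
    ← Finset.mul_sum]
  ring

lemma spectralObjective_le (hρ : 0 < ρ) (Y L : Tensor3 ℝ n₁ n₂ n₃) :
    spectralObjective ρ ν ϑ c w Y L ≤ n₃ * proxObjective ρ ν ϑ c w Y L := by
  rw [proxObjective_eq]
  have := Finset.sum_nonneg fun i (_ : i ∈ Finset.univ) => mirskyGap_nonneg Y L i
  have : 0 ≤ ρ / 2 * ∑ i, mirskyGap Y L i := by positivity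
  linarith

lemma proxObjective_of_common_tsvd {Y L : Tensor3 ℝ n₁ n₂ n₃} {U : Tensor3 ℝ n₁ n₁ n₃}
    {S₁ S₂ : Tensor3 ℝ n₁ n₂ n₃} {V : Tensor3 ℝ n₂ n₂ n₃} (hL : IsTSVD L U S₁ V)
    (hY : IsTSVD Y U S₂ V) :
    (n₃ : ℝ) * proxObjective ρ ν ϑ c w Y L = spectralObjective ρ ν ϑ c w Y L := by
  rw [proxObjective_eq, Finset.sum_eq_zero fun i _ => ?_, mul_zero, add_zero]
  exact sub_eq_zero.2 (sum_norm_sub_sq_of_isTSVD hL hY i)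

theorem mem_proxSet_of_common_tsvd (hρ : 0 < ρ) {Y L : Tensor3 ℝ n₁ n₂ n₃}
    {U : Tensor3 ℝ n₁ n₁ n₃} {S₁ S₂ : Tensor3 ℝ n₁ n₂ n₃} {V : Tensor3 ℝ n₂ n₂ n₃}
    (hL : IsTSVD L U S₁ V) (hY : IsTSVD Y U S₂ V)
    (h : ∀ i j, sv L i j ∈ scalarProxSet ρ ν ϑ (weight c w j i) (sv Y i j)) :
    L ∈ proxSet ρ ν ϑ c w Y := by
  intro L'
  have hn : (0 : ℝ) < n₃ := Nat.cast_pos.2 (NeZero.pos n₃)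
  refine le_of_mul_le_mul_left ?_ hn
  rw [proxObjective_of_common_tsvd hL hY]
  exact (spectralObjective_le_of_mem h L').trans (spectralObjective_le hρ Y L')

/-- Applying a selection of scalar minimizers to the singular values in a t-SVD. -/
theorem exists_tsvd_scalarProx (hρ : 0 < ρ) (hν : 0 < ν) (hϑ : 0 < ϑ) (hc : 0 ≤ c)
    (hw : ∀ j i, w j (-i) = w j i) {Y : Tensor3 ℝ n₁ n₂ n₃}
    (hord : ∀ (i : Fin n₃) (j k : Fin (min n₁ n₂)), j ≤ k →
      weight c w j i * sv Y i k ≤ weight c w k i * sv Y i j)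
    {SLC : ℝ → ℝ → ℝ}
    (hS : ∀ ω y : ℝ, 0 < ω → 0 ≤ y → SLC ω y ∈ scalarProxSet ρ ν ϑ ω y)
    {U : Tensor3 ℝ n₁ n₁ n₃} {S₂ : Tensor3 ℝ n₁ n₂ n₃} {V : Tensor3 ℝ n₂ n₂ n₃}
    (hY : IsTSVD Y U S₂ V) :
    ∃ S₁ : Tensor3 ℝ n₁ n₂ n₃,
      IsTSVD (tMul (tMul U S₁) (tconj V)) U S₁ V ∧
      ∀ i j, sv (tMul (tMul U S₁) (tconj V)) i j = SLC (weight c w j i) (sv Y i j) := by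
  obtain ⟨hU, hV, -, -⟩ := isTSVD_iff.1 hY
  have hmem := fun (i : Fin n₃) (j : Fin (min n₁ n₂)) =>
    hS (weight c w j i) (sv Y i j) (weight_pos hc j i) (sv_nonneg Y i j)
  let s : Fin n₃ → ℕ → ℝ := fun i j =>
    if h : j < min n₁ n₂ then SLC (weight c w ⟨j, h⟩ i) (sv Y i ⟨j, h⟩) else 0
  have hs : ∀ i j (h : j < min n₁ n₂), s i j = SLC (weight c w ⟨j, h⟩ i) (sv Y i ⟨j, h⟩) :=
    fun i j h => dif_pos h
  -- Conjugate slices have equal weights and equal singular values, hence equal new values, so the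
  -- diagonal comes from a real tensor.
  obtain ⟨S₁, hS₁⟩ := exists_dft_eq_rectDiag (n₁ := n₁) (n₂ := n₂) (s := s) fun i j hj => by
    rw [hs _ _ hj, hs _ _ hj, sv_neg, weight, weight, hw]
  have hfac : ∀ i, dft (tMul (tMul U S₁) (tconj V)) i =
      dft U i * rectDiag ℂ n₁ n₂ (s i) * (dft V i)ᴴ := fun i => by
    rw [dft_tMul, dft_tMul, dft_tconj, hS₁]
  have hsig : ∀ i, ∀ j < min n₁ n₂, sigma (dft (tMul (tMul U S₁) (tconj V)) i) j = s i j := by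
    intro i
    refine sigma_of_svd (hU i) (hV i) (fun j hj => ?_) (fun j k hjk hk => ?_) (hfac i)
    · rw [hs _ _ hj]
      exact (hmem i _).1
    · rw [hs _ _ hk, hs _ _ (hjk.trans_lt hk)]
      -- Without this ordering the new diagonal would list the singular values in the wrong
      -- positions.
      exact scalarProx_antitone hρ hν hϑ hS (weight_pos hc _ i) (weight_pos hc _ i)
        (sv_nonneg Y i _) (sv_antitone Y i hjk) (hord i _ _ hjk)
  refine ⟨S₁, isTSVD_iff.2 ⟨hU, hV, fun i => ?_, fun i => ?_⟩, fun i j => ?_⟩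
  · rw [hS₁]
    exact (rectDiag_congr (hsig i)).symm
  · rw [hfac, hS₁]
  · exact (hsig i j j.2).trans (hs i j j.2)

/-- A minimizer is compared with one built from scalar minimizers. The spectral excess and the gaps
are nonnegative with nonpositive weighted total, so all vanish: zero gaps give common factors, and
zero excess gives optimality term by term. -/
theorem exists_of_mem_proxSet (hρ : 0 < ρ) (hν : 0 < ν) (hϑ : 0 < ϑ) (hc : 0 ≤ c)
    (hw : ∀ j i, w j (-i) = w j i) {Y : Tensor3 ℝ n₁ n₂ n₃}
    (hord : ∀ (i : Fin n₃) (j k : Fin (min n₁ n₂)), j ≤ k →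
      weight c w j i * sv Y i k ≤ weight c w k i * sv Y i j)
    {L : Tensor3 ℝ n₁ n₂ n₃} (hL : L ∈ proxSet ρ ν ϑ c w Y) :
    ∃ U S₁ S₂ V, IsTSVD Y U S₂ V ∧ IsTSVD L U S₁ V ∧
      ∀ i j, sv L i j ∈ scalarProxSet ρ ν ϑ (weight c w j i) (sv Y i j) := by
  -- The implications sit inside the existential so that `choose` yields a total function; the value
  -- `0` outside the domain is irrelevant.
  have hne : ∀ ω y : ℝ, ∃ l, 0 < ω → 0 ≤ y → l ∈ scalarProxSet ρ ν ϑ ω y := fun ω y => by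
    by_cases h : 0 < ω ∧ 0 ≤ y
    · obtain ⟨l, hl⟩ := scalarProxSet_nonempty hρ hν hϑ h.1 h.2
      exact ⟨l, fun _ _ => hl⟩
    · exact ⟨0, fun h1 h2 => absurd ⟨h1, h2⟩ h⟩
  choose SLC hS using hne
  obtain ⟨U, S₂, V, hY⟩ := exists_tsvd Y
  obtain ⟨S₁, hT, hsv⟩ := exists_tsvd_scalarProx hρ hν hϑ hc hw hord hS hY
  set L₀ := tMul (tMul U S₁) (tconj V)
  have hmem : ∀ i j, sv L₀ i j ∈ scalarProxSet ρ ν ϑ (weight c w j i) (sv Y i j) := fun i j => by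
    rw [hsv]
    exact hS _ _ (weight_pos hc j i) (sv_nonneg Y i j)
  have h1 := spectralObjective_le_of_mem hmem L
  have h2 : (n₃ : ℝ) * proxObjective ρ ν ϑ c w Y L ≤ n₃ * proxObjective ρ ν ϑ c w Y L₀ :=
    mul_le_mul_of_nonneg_left (hL L₀) (Nat.cast_nonneg _)
  rw [proxObjective_of_common_tsvd hT hY, proxObjective_eq] at h2
  have hgap := Finset.sum_nonneg fun i (_ : i ∈ Finset.univ) => mirskyGap_nonneg Y L i
  have hgap' : 0 ≤ ρ / 2 * ∑ i, mirskyGap Y L i := by positivity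
  have hgap0 : ∑ i, mirskyGap Y L i = 0 := by
    have : ρ / 2 * ∑ i, mirskyGap Y L i = 0 := by linarith
    exact (mul_eq_zero.1 this).resolve_left (by positivity)
  have heq : spectralObjective ρ ν ϑ c w Y L₀ = spectralObjective ρ ν ϑ c w Y L := by linarith
  obtain ⟨U', S₁', S₂', V', hY', hL'⟩ := exists_common_tsvd (X := L) (Y := Y) fun i =>
    sub_eq_zero.1 ((Finset.sum_eq_zero_iff_of_nonneg fun i _ => mirskyGap_nonneg Y L i).1 hgap0 i
      (Finset.mem_univ i))
  refine ⟨U', S₁', S₂', V', hY', hL', fun i j => ⟨sv_nonneg L i j, fun l hl => ?_⟩⟩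
  have hle : ∀ i j, scalarObjective ρ ν ϑ (weight c w j i) (sv Y i j) (sv L₀ i j) ≤
      scalarObjective ρ ν ϑ (weight c w j i) (sv Y i j) (sv L i j) :=
    fun i j => (hmem i j).2 _ (sv_nonneg L i j)
  have hi := (Finset.sum_eq_sum_iff_of_le fun i _ =>
    Finset.sum_le_sum fun j _ => hle i j).1 heq i (Finset.mem_univ i)
  have hij := (Finset.sum_eq_sum_iff_of_le fun j _ => hle i j).1 hi j (Finset.mem_univ j)
  rw [← hij]
  exact (hmem i j).2 l hl

end Prox

end TensorLC

open TensorLC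
theorem theorem2 (n₁ n₂ n₃ : ℕ) [NeZero n₃] (ρ ν ϑ c : ℝ)
    (hρ : 0 < ρ) (hν : 0 < ν) (hϑ : 0 < ϑ) (hc : 0 ≤ c)
    (w : Fin (min n₁ n₂) → Fin n₃ → ℝ)
    -- weights agree on complex conjugate Fourier slices
    (hw : ∀ j i, w j (-i) = w j i)
    (Y : Tensor3 ℝ n₁ n₂ n₃)
    -- `ω_{j,i} σ_k ≤ ω_{k,i} σ_j` for `j ≤ k`; automatic if `j ↦ ω_{j,i}` is nondecreasing
    (hord : ∀ (i : Fin n₃) (j k : Fin (min n₁ n₂)), j ≤ k →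
      weight c w j i * sv Y i k ≤ weight c w k i * sv Y i j) :
    -- the scalar map: minimizers exist and are found among finitely many candidates
    (∀ ω y : ℝ, 0 < ω → 0 ≤ y →
      (scalarProxSet ρ ν ϑ ω y).Nonempty ∧
      (∀ l : ℝ, l ∈ scalarProxSet ρ ν ϑ ω y ↔
        (l ∈ candidates ρ ν ϑ ω y ∧
          (∀ x ∈ candidates ρ ν ϑ ω y,
            scalarObjective ρ ν ϑ ω y l ≤ scalarObjective ρ ν ϑ ω y x) ∧
          scalarObjective ρ ν ϑ ω y l ≤ scalarObjective ρ ν ϑ ω y y) ∨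
        (ν * ϑ < l ∧ l = y ∧
          ∀ x ∈ candidates ρ ν ϑ ω y,
            scalarObjective ρ ν ϑ ω y y ≤ scalarObjective ρ ν ϑ ω y x)) ∧
      ((∀ x ∈ candidates ρ ν ϑ ω y,
          scalarObjective ρ ν ϑ ω y (ν * ϑ) ≤ scalarObjective ρ ν ϑ ω y x) →
        y ∈ scalarProxSet ρ ν ϑ ω y)) ∧
    -- a t-SVD of `Y` exists
    (∃ U S₂ V, IsTSVD Y U S₂ V) ∧
    -- every choice of `S_LC` and every t-SVD of `Y` give a point of the proximal map
    (∀ SLC : ℝ → ℝ → ℝ,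
      (∀ ω y : ℝ, 0 < ω → 0 ≤ y → SLC ω y ∈ scalarProxSet ρ ν ϑ ω y) →
      ∀ U S₂ V, IsTSVD Y U S₂ V →
        ∃ S₁ : Tensor3 ℝ n₁ n₂ n₃,
          IsTSVD (tMul (tMul U S₁) (tconj V)) U S₁ V ∧
          (∀ i j, sv (tMul (tMul U S₁) (tconj V)) i j = SLC (weight c w j i) (sv Y i j)) ∧
          tMul (tMul U S₁) (tconj V) ∈ proxSet ρ ν ϑ c w Y) ∧
    -- the proximal map consists exactly of the tensors of this form
    (∀ L : Tensor3 ℝ n₁ n₂ n₃, L ∈ proxSet ρ ν ϑ c w Y ↔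
      ∃ U S₁ S₂ V, IsTSVD Y U S₂ V ∧ IsTSVD L U S₁ V ∧
        ∀ i j, sv L i j ∈ scalarProxSet ρ ν ϑ (weight c w j i) (sv Y i j)) := by
  refine ⟨fun ω y hω hy => ⟨scalarProxSet_nonempty hρ hν hϑ hω hy,
    mem_scalarProxSet_iff hρ hν hϑ hω hy, self_mem_scalarProxSet hρ hν hϑ hω hy⟩,
    exists_tsvd Y, fun SLC hS U S₂ V hY => ?_,
    fun L => ⟨exists_of_mem_proxSet hρ hν hϑ hc hw hord, ?_⟩⟩
  · obtain ⟨S₁, hT, hsv⟩ := exists_tsvd_scalarProx hρ hν hϑ hc hw hord hS hY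
    refine ⟨S₁, hT, hsv, mem_proxSet_of_common_tsvd hρ hT hY fun i j => ?_⟩
    rw [hsv]
    exact hS _ _ (weight_pos hc j i) (sv_nonneg Y i j)
  · rintro ⟨U, S₁, S₂, V, hY, hL, h⟩
    exact mem_proxSet_of_common_tsvd hρ hL hY h
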